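/- Let $\mathcal H$ be a complex Hilbert space, $B(\mathcal H)$ the bounded operators, $S_1(\mathcal H)$ the trace-class operators, and $S_2(\mathcal H)$ the Hilbert–Schmidt operators with inner product $\langle a,b\rangle=\operatorname{Tr}(a^*b)$. Let $(T_t)_{t\ge 0}$ be a semigroup of bounded linear operators on $B(\mathcal H)$ ($T_0=I$, $T_{t+s}=T_tT_s$) each of which is a Schwarz map, i.e. $T_t(x)^*T_t(x)\le T_t(x^*x)$ for all $x\in B(\mathcal H)$. Let $\rho\in S_1(\mathcal H)$ be positive with $\operatorname{Tr}\rho=1$ such that the normal state $\omega_\rho(x)=\operatorname{Tr}(\rho x)$ is faithful ($\omega_\rho(x)>0$ for every $x\ge 0$, $x\neq 0$) and subinvariant: $\omega_\rho(T_t(a))\le\omega_\rho(a)$ for all $t\ge 0$ and all $a\ge 0$. Put $i_\rho(x)=\rho^{1/4}x\rho^{1/4}$ for $x\in B(\mathcal H)$. Then $i_\rho(x)\in S_2(\mathcal H)$ for every $x\in B(\mathcal H)$, and: 1. There is a unique semigroup $(\widetilde T_t)_{t\ge 0}$ of linear contractions on $S_2(\mathcal H)$ with $\widetilde T_t(i_\rho(x))=i_\rho(T_t(x))$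 for all $x\in B(\mathcal H)$ and $t\ge 0$. 2. If $(T_t)$ is weak$^*$-continuous (that is, $t\mapsto \operatorname{Tr}(a\,T_t(x))$ is continuous on $[0,\infty)$ for all $a\in S_1(\mathcal H)$, $x\in B(\mathcal H)$), then $(\widetilde T_t)$ is strongly continuous. 3. Let $L$ be the generator of $(T_t)$: $x\in D(L)$ iff $\frac{T_t(x)-x}{t}$ converges in the weak$^*$ topology of $B(\mathcal H)=S_1(\mathcal H)^*$ as $t\to 0^+$, and $L(x)$ is the limit. Let $\widetilde L$ be the generator of $(\widetilde T_t)$, defined in the same way with limits in the norm of $S_2(\mathcal H)$. If $x\in D(L)$, then $i_\rho(x)\in D(\widetilde L)$ and $\widetilde L(i_\rho(x))=i_\rho(L(x))$. 4. Let $(h_n)_{n\in N}$ be any orthonormal basis of $\mathcal H$ consisting of eigenvectors of $\rho$. The extended generator $L_{(h_n)}$ of $(T_t)$ has as domain the set of all $x\in B(\mathcal H)$ such that $\lim_{t\to 0^+}\langle h_n,\frac{T_t(x)-x}{t}h_m\rangle$ exists for all $n,m\in N$, and $L_{(h_n)}(x)$ is the $N\times N$ matrix of these limits. A matrix $M$ acts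 on the vectors $h\in\mathcal H$ for which all series $\sum_m M_{n,m}\langle h_m,h\rangle$ converge unconditionally, giving the family $(\sum_m M_{n,m}\langle h_m,h\rangle)_{n\in N}$. Let $r=(\rho^{1/4})^{(-1)}$ be the Moore–Penrose inverse of $\rho^{1/4}$, with domain $\mathcal R(\rho^{1/4})+\mathcal R(\rho^{1/4})^\perp$, and $i_{\rho^{(-1)}}(y)=r\,y\,r$. If $x\in B(\mathcal H)$ and $i_\rho(x)\in D(\widetilde L)$, then $x\in D(L_{(h_n)})$ and $L_{(h_n)}(x)=i_{\rho^{(-1)}}(\widetilde L(i_\rho(x)))$ in the following sense. Write $y=\widetilde L(i_\rho(x))$. All $h_n$ lie in the domain of $r$, the matrix entries satisfy $$[L_{(h_n)}(x)]_{n,m}=\langle r h_n,\; y\, r h_m\rangle\qquad(n,m\in N),$$ and every vector $v$ in the natural domain $\{v\in D(r): y\,r v\in D(r)\}$ of $r\,y\,r$ lies in the domain of the matrix $L_{(h_n)}(x)$, which maps it to the family of coordinates $(\langle h_n, r\,y\,r v\rangle)_{n\in N}$. -/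

import Mathlib

open Filter Topology
open scoped NNReal InnerProductSpace ComplexOrder

noncomputable section

/-! ## Trace, trace-class operators and Hilbert–Schmidt operators -/

section Schatten

variable (H : Type*) [NormedAddCommGroup H] [InnerProductSpace ℂ H] [CompleteSpace H]

/-- The index set of a fixed orthonormal basis of `H`. -/
def refIndex : Set H := (exists_hilbertBasis ℂ H).choose

/-- A fixed orthonormal basis of `H`. The notions defined from it below (positive operators of
finite trace, the trace of a trace-class operator, the Hilbert–Schmidt inner product) do not depend
on its choice. -/
def refBasis : HilbertBasis (refIndex H) ℂ H := (exists_hilbertBasis ℂ H).choose_spec.choose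

variable {H}

/-- The trace `∑ ⟨e, a e⟩` over an orthonormal basis (meaningful for trace-class `a`). -/
def opTrace (a : H →L[ℂ] H) : ℂ := ∑' i, ⟪refBasis H i, a (refBasis H i)⟫_ℂ

/-- `a ∈ S₁(H)`: the positive operator `|a| = (a⋆ a)^{1/2}` has finite trace. -/
def IsTraceClass (a : H →L[ℂ] H) : Prop :=
  Summable fun i => (⟪refBasis H i, CFC.abs a (refBasis H i)⟫_ℂ).re

/-- `a ∈ S₂(H)`: `∑ ‖a e‖² < ∞` over an orthonormal basis. -/
def IsHilbertSchmidt (a : H →L[ℂ] H) : Prop :=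
  Summable fun i => ‖a (refBasis H i)‖ ^ 2

theorem IsHilbertSchmidt.add {a b : H →L[ℂ] H} (ha : IsHilbertSchmidt a)
    (hb : IsHilbertSchmidt b) : IsHilbertSchmidt (a + b) := by
  have h : Summable fun i => 2 * (‖a (refBasis H i)‖ ^ 2 + ‖b (refBasis H i)‖ ^ 2) :=
    (Summable.add ha hb).mul_left 2
  refine Summable.of_nonneg_of_le (fun i => by positivity) (fun i => ?_) h
  have h1 := norm_add_le (a (refBasis H i)) (b (refBasis H i))
  have h2 := norm_nonneg (a (refBasis H i) + b (refBasis H i))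
  rw [add_apply]
  nlinarith [sq_nonneg (‖a (refBasis H i)‖ - ‖b (refBasis H i)‖)]

theorem IsHilbertSchmidt.smul (c : ℂ) {a : H →L[ℂ] H} (ha : IsHilbertSchmidt a) :
    IsHilbertSchmidt (c • a) := by
  have h : Summable fun i => ‖c‖ ^ 2 * ‖a (refBasis H i)‖ ^ 2 := Summable.mul_left _ ha
  simpa [IsHilbertSchmidt, norm_smul, mul_pow] using h

variable (H)

/-- The Hilbert–Schmidt operators as a linear subspace of `B(H)`. -/
def hsSubmodule : Submodule ℂ (H →L[ℂ] H) where
  carrier := {a | IsHilbertSchmidt a}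
  zero_mem' := by simp [IsHilbertSchmidt]
  add_mem' := fun ha hb => ha.add hb
  smul_mem' := fun c _ ha => ha.smul c

/-- The space `S₂(H)`. It is a new type, so that it carries the Hilbert–Schmidt norm defined below
and not the operator norm. -/
def S2 : Type _ := ↥(hsSubmodule H)

instance : AddCommGroup (S2 H) := inferInstanceAs (AddCommGroup ↥(hsSubmodule H))

instance : Module ℂ (S2 H) := inferInstanceAs (Module ℂ ↥(hsSubmodule H))

variable {H}

/-- The inclusion `S₂(H) ⊆ B(H)`. -/
def S2.toOp : S2 H →ₗ[ℂ] (H →L[ℂ] H) := (hsSubmodule H).subtype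

/-- A Hilbert–Schmidt operator as an element of `S₂(H)`. -/
def S2.mk (a : H →L[ℂ] H) (ha : IsHilbertSchmidt a) : S2 H := ⟨a, ha⟩

theorem S2.toOp_mk (a : H →L[ℂ] H) (ha : IsHilbertSchmidt a) : S2.toOp (S2.mk a ha) = a := rfl

theorem S2.prop (a : S2 H) : IsHilbertSchmidt (S2.toOp a) := Subtype.property a

theorem S2.ext {a b : S2 H} (h : S2.toOp a = S2.toOp b) : a = b := Subtype.ext h

theorem S2.summable_inner (a b : S2 H) :
    Summable fun i => ⟪S2.toOp a (refBasis H i), S2.toOp b (refBasis H i)⟫_ℂ := by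
  refine Summable.of_norm_bounded (g := fun i =>
    ‖S2.toOp a (refBasis H i)‖ ^ 2 + ‖S2.toOp b (refBasis H i)‖ ^ 2)
    (Summable.add a.prop b.prop) fun i => ?_
  have h1 := norm_inner_le_norm (𝕜 := ℂ) (S2.toOp a (refBasis H i)) (S2.toOp b (refBasis H i))
  nlinarith [sq_nonneg (‖S2.toOp a (refBasis H i)‖ - ‖S2.toOp b (refBasis H i)‖),
    sq_nonneg (‖S2.toOp a (refBasis H i)‖), sq_nonneg (‖S2.toOp b (refBasis H i)‖)]

theorem op_eq_zero_of_refBasis (a : H →L[ℂ] H) (h : ∀ i, a (refBasis H i) = 0) : a = 0 := by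
  have h2 : Set.EqOn a (0 : H →L[ℂ] H) (Submodule.span ℂ (Set.range (refBasis H))) := by
    refine LinearMap.eqOn_span' (f := (a : H →ₗ[ℂ] H)) (g := 0) ?_
    rintro _ ⟨i, rfl⟩
    exact h i
  ext x
  have h3 : Dense (Submodule.span ℂ (Set.range (refBasis H)) : Set H) := by
    rw [Submodule.dense_iff_topologicalClosure_eq_top]
    exact (refBasis H).dense_span
  exact congrFun (Continuous.ext_on h3 a.continuous
    (0 : H →L[ℂ] H).continuous h2) x

variable (H)

/-- The Hilbert–Schmidt inner product `⟨a, b⟩ = Tr (a⋆ b) = ∑ ⟨a e, b e⟩`. -/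
@[reducible]
def hsCore : InnerProductSpace.Core ℂ (S2 H) where
  inner a b := ∑' i, ⟪S2.toOp a (refBasis H i), S2.toOp b (refBasis H i)⟫_ℂ
  conj_inner_symm a b := by
    rw [Complex.conj_tsum]
    simp
  re_inner_nonneg a := by
    have h := (S2.summable_inner a a)
    rw [RCLike.re_eq_complex_re, Complex.re_tsum h]
    exact tsum_nonneg fun i => inner_self_nonneg (𝕜 := ℂ)
  add_left a b c := by
    rw [← (S2.summable_inner a c).tsum_add (S2.summable_inner b c)]
    simp
  smul_left a b r := by
    rw [← tsum_mul_left]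
    simp [mul_comm]
  definite a h := by
    have h1 : (∑' i, ‖S2.toOp a (refBasis H i)‖ ^ 2) = 0 := by
      have h2 := congrArg Complex.re h
      rw [Complex.re_tsum (S2.summable_inner a a)] at h2
      simpa [inner_self_eq_norm_sq_to_K, ← Complex.ofReal_pow] using h2
    have h3 := (hasSum_zero_iff_of_nonneg (fun i => by positivity)).1
      (h1 ▸ (a.prop : Summable _).hasSum)
    refine S2.ext ?_
    rw [map_zero]
    refine op_eq_zero_of_refBasis _ fun i => ?_
    have h4 := congrFun h3 i
    simpa using h4

instance : NormedAddCommGroup (S2 H) :=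
  @InnerProductSpace.Core.toNormedAddCommGroup ℂ (S2 H) _ _ _ (hsCore H)

instance : InnerProductSpace ℂ (S2 H) := InnerProductSpace.ofCore (hsCore H).toCore

end Schatten

/-! ## Normal states, Schwarz maps, semigroups -/

section Semigroups

variable {H : Type*} [NormedAddCommGroup H] [InnerProductSpace ℂ H] [CompleteSpace H]

/-- The normal functional `ω_ρ(x) = Tr (ρ x)`. -/
def normalFunctional (ρ x : H →L[ℂ] H) : ℂ := opTrace (ρ * x)

/-- `ρ` is a positive trace-class operator of trace one such that `ω_ρ` is faithful, that is,
`ω_ρ` is a faithful normal state. -/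
structure IsFaithfulNormalState (ρ : H →L[ℂ] H) : Prop where
  nonneg : 0 ≤ ρ
  traceClass : IsTraceClass ρ
  trace_eq_one : opTrace ρ = 1
  faithful : ∀ x : H →L[ℂ] H, 0 ≤ x → x ≠ 0 → 0 < normalFunctional ρ x

/-- Schwarz maps: bounded linear maps with `T(x)⋆ T(x) ≤ T(x⋆ x)`. -/
def IsSchwarzMap (T : (H →L[ℂ] H) →L[ℂ] (H →L[ℂ] H)) : Prop :=
  ∀ x, star (T x) * T x ≤ T (star x * x)

/-- `ω_ρ` is subinvariant for `T`. -/
def IsSubinvariant (ρ : H →L[ℂ] H) (T : (H →L[ℂ] H) →L[ℂ] (H →L[ℂ] H)) : Prop :=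
  ∀ a, 0 ≤ a → normalFunctional ρ (T a) ≤ normalFunctional ρ a

/-- One-parameter semigroups of bounded operators. -/
structure IsOpSemigroup {X : Type*} [NormedAddCommGroup X] [NormedSpace ℂ X]
    (T : ℝ≥0 → X →L[ℂ] X) : Prop where
  map_zero : T 0 = ContinuousLinearMap.id ℂ X
  map_add : ∀ t s, T (t + s) = (T t).comp (T s)

/-- Strong continuity of a semigroup. -/
def IsStronglyContinuous {X : Type*} [NormedAddCommGroup X] [NormedSpace ℂ X]
    (T : ℝ≥0 → X →L[ℂ] X) : Prop :=
  ∀ x, Continuous fun t => T t x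

/-- Weak* continuity on `B(H) = S₁(H)*`, the duality being `(a, x) ↦ Tr (a x)`. -/
def IsWeakStarContinuous (T : ℝ≥0 → (H →L[ℂ] H) →L[ℂ] (H →L[ℂ] H)) : Prop :=
  ∀ a, IsTraceClass a → ∀ x, Continuous fun t => opTrace (a * T t x)

/-- The difference quotient `(T_t x - x) / t`. -/
def diffQuot {X : Type*} [NormedAddCommGroup X] [NormedSpace ℂ X]
    (T : ℝ≥0 → X →L[ℂ] X) (x : X) (t : ℝ≥0) : X :=
  (((t : ℝ) : ℂ)⁻¹) • (T t x - x)

/-- Domain of the generator, with limits taken in norm. -/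
def genDomain {X : Type*} [NormedAddCommGroup X] [NormedSpace ℂ X]
    (T : ℝ≥0 → X →L[ℂ] X) : Set X :=
  {x | ∃ z, Tendsto (diffQuot T x) (𝓝[>] 0) (𝓝 z)}

/-- The generator, with limits taken in norm (meaningful on `genDomain T`). -/
def gen {X : Type*} [NormedAddCommGroup X] [NormedSpace ℂ X]
    (T : ℝ≥0 → X →L[ℂ] X) (x : X) : X :=
  limUnder (𝓝[>] 0) (diffQuot T x)

/-- `z` is the weak* limit of `(T_t x - x) / t` as `t → 0`. -/
def IsWeakStarDeriv (T : ℝ≥0 → (H →L[ℂ] H) →L[ℂ] (H →L[ℂ] H)) (x z : H →L[ℂ] H) : Prop :=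
  ∀ a, IsTraceClass a →
    Tendsto (fun t => opTrace (a * diffQuot T x t)) (𝓝[>] 0) (𝓝 (opTrace (a * z)))

/-- Domain `D(L)` of the generator of a semigroup on `B(H)`, with limits taken weak*. -/
def weakStarGenDomain (T : ℝ≥0 → (H →L[ℂ] H) →L[ℂ] (H →L[ℂ] H)) : Set (H →L[ℂ] H) :=
  {x | ∃ z, IsWeakStarDeriv T x z}

open Classical in
/-- The generator `L` of a semigroup on `B(H)`, with limits taken weak* (meaningful on
`weakStarGenDomain T`, where the limit is unique). -/
def weakStarGen (T : ℝ≥0 → (H →L[ℂ] H) →L[ℂ] (H →L[ℂ] H)) (x : H →L[ℂ] H) : H →L[ℂ] H :=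
  if h : ∃ z, IsWeakStarDeriv T x z then h.choose else 0

/-! ## The extended generator with respect to an orthonormal basis -/

variable {ι : Type*}

/-- Domain of the extended generator `L_{(h_n)}`: all matrix entries of the difference quotients
have a limit. -/
def extGenDomain (T : ℝ≥0 → (H →L[ℂ] H) →L[ℂ] (H →L[ℂ] H)) (h : HilbertBasis ι ℂ H) :
    Set (H →L[ℂ] H) :=
  {x | ∀ n m, ∃ c, Tendsto (fun t => ⟪h n, diffQuot T x t (h m)⟫_ℂ) (𝓝[>] 0) (𝓝 c)}

/-- The extended generator `L_{(h_n)}`, whose values are matrices (meaningful on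
`extGenDomain T h`). -/
def extGen (T : ℝ≥0 → (H →L[ℂ] H) →L[ℂ] (H →L[ℂ] H)) (h : HilbertBasis ι ℂ H)
    (x : H →L[ℂ] H) : Matrix ι ι ℂ :=
  Matrix.of fun n m => limUnder (𝓝[>] 0) fun t => ⟪h n, diffQuot T x t (h m)⟫_ℂ

/-- The domain in `H` of a matrix, viewed as a linear map acting on coordinates with respect to
the orthonormal basis `h`. -/
def matrixDomain (h : HilbertBasis ι ℂ H) (M : Matrix ι ι ℂ) : Set H :=
  {v | ∀ n, Summable fun m => M n m * ⟪h m, v⟫_ℂ}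

/-- The action of a matrix on a vector of its domain; the value is a family of coordinates. -/
def matrixApply (h : HilbertBasis ι ℂ H) (M : Matrix ι ι ℂ) (v : H) : ι → ℂ :=
  fun n => ∑' m, M n m * ⟪h m, v⟫_ℂ

end Semigroups

/-! ## The maps `i_ρ` and `i_{ρ^{(-1)}}` -/

section Embedding

variable {H : Type*} [NormedAddCommGroup H] [InnerProductSpace ℂ H]

/-- `i_ρ(x) = ρ^{1/4} x ρ^{1/4}`. -/
def iRho [CompleteSpace H] (ρ x : H →L[ℂ] H) : H →L[ℂ] H := ρ ^ (1 / 4 : ℝ) * x * ρ ^ (1 / 4 : ℝ)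

/-- The graph of the Moore–Penrose inverse of `x`: pairs `(k, u)` such that `u ∈ N(x)ᗮ` and
`k = x u + v` for some `v ∈ R(x)ᗮ`. -/
def pinvGraph (x : H →L[ℂ] H) : Submodule ℂ (H × H) where
  carrier := {p | p.2 ∈ (LinearMap.ker (x : H →ₗ[ℂ] H))ᗮ ∧
    p.1 - x p.2 ∈ (LinearMap.range (x : H →ₗ[ℂ] H))ᗮ}
  zero_mem' := by simp
  add_mem' := by
    rintro ⟨k, u⟩ ⟨k', u'⟩ ⟨h1, h2⟩ ⟨h1', h2'⟩
    refine ⟨Submodule.add_mem _ h1 h1', ?_⟩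
    have h3 := Submodule.add_mem _ h2 h2'
    simp only [Prod.mk_add_mk, map_add] at h3 ⊢
    rwa [add_sub_add_comm]
  smul_mem' := by
    rintro c ⟨k, u⟩ ⟨h1, h2⟩
    refine ⟨Submodule.smul_mem _ c h1, ?_⟩
    have h3 := Submodule.smul_mem _ c h2
    simp only [Prod.smul_mk, map_smul] at h3 ⊢
    rwa [← smul_sub]

/-- `pinvGraph x` is single-valued. -/
theorem pinvGraph_snd_eq_zero (x : H →L[ℂ] H) :
    ∀ p ∈ pinvGraph x, p.1 = 0 → p.2 = 0 := by
  rintro ⟨k, u⟩ ⟨h1, h2⟩ hk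
  simp only at h1 h2 hk ⊢
  subst hk
  have h3 : x u = 0 := by
    have h4 : x u ∈ (LinearMap.range (x : H →ₗ[ℂ] H))ᗮ := by simpa using h2
    exact inner_self_eq_zero.1 (h4 (x u) ⟨u, rfl⟩)
  exact inner_self_eq_zero.1 (h1 u h3)

/-- The Moore–Penrose inverse `x^{(-1)}`, with domain `R(x) + R(x)ᗮ`. -/
def pinv (x : H →L[ℂ] H) : H →ₗ.[ℂ] H := (pinvGraph x).toLinearPMap

/-- Composition of partially defined linear maps on its natural domain. -/
def pmapComp (g f : H →ₗ.[ℂ] H) : H →ₗ.[ℂ] H :=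
  g.comp (f.domRestrict ((g.domain.comap f.toFun).map f.domain.subtype)) (by
    rintro ⟨v, hv, hv'⟩
    obtain ⟨w, hw, rfl⟩ := hv
    exact hw)

/-- `i_{ρ^{(-1)}}(y) = (ρ^{1/4})^{(-1)} y (ρ^{1/4})^{(-1)}` on its natural domain. -/
def iRhoInv [CompleteSpace H] (ρ y : H →L[ℂ] H) : H →ₗ.[ℂ] H :=
  pmapComp (pinv (ρ ^ (1 / 4 : ℝ)))
    ((y : H →ₗ[ℂ] H).compPMap (pinv (ρ ^ (1 / 4 : ℝ))))

/-- `Tt` is a semigroup of contractions on `S₂(H)` such that `Tt_t (i_ρ(x)) = i_ρ(T_t(x))` for all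
`x ∈ B(H)`. Here `hi` says that `i_ρ` takes values in `S₂(H)`. -/
structure IsInducedSemigroup [CompleteSpace H] (ρ : H →L[ℂ] H)
    (hi : ∀ x : H →L[ℂ] H, IsHilbertSchmidt (iRho ρ x))
    (T : ℝ≥0 → (H →L[ℂ] H) →L[ℂ] (H →L[ℂ] H)) (Tt : ℝ≥0 → S2 H →L[ℂ] S2 H) : Prop where
  semigroup : IsOpSemigroup Tt
  contraction : ∀ t, ‖Tt t‖ ≤ 1
  intertwine : ∀ t x, Tt t (S2.mk (iRho ρ x) (hi x)) = S2.mk (iRho ρ (T t x)) (hi (T t x))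

end Embedding

end

/-! Everything rests on one estimate: a Schwarz map `T` with subinvariant `ω_ρ` does not increase
the Hilbert–Schmidt norm of `i_ρ(x)`. In an eigenbasis of `ρ`, where `ρ^{1/4}` has eigenvalues `μ n
> 0`, the quantities `ω_ρ(x⋆x)`, `ω_ρ(xx⋆)` and `‖i_ρ(x)‖²` are sums of squared matrix entries of
`x` with weights `μ_col⁴`, `μ_row⁴` and `μ_row² μ_col²`. The Schwarz inequality and subinvariance
contract the first sum; as `T` preserves adjoints, they contract the second. The third weight is the
geometric mean, so interpolation contracts it. For finitely many entries this is a spectral radius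
argument (`CStarAlgebra.norm_conj_le_one`); the passage to all `x` in `norm_iRho_map_le` uses
contraction of `ω_ρ(x⋆x)` rather than normality of `T`.

Since `i_ρ` has dense range, the maps extend uniquely to contractions of `S₂(H)`. Weak information
about Hilbert-space contractions then becomes strong. If `⟪ξ, S_t ξ⟫ → ‖ξ‖²`, then `S_t ξ → ξ`,
which gives strong continuity. If the difference quotients at `ξ` converge weakly to `ζ`, a mean
value inequality bounds them by `‖ζ‖`, so they converge in norm
(`IsOpSemigroup.tendsto_diffQuot_of_weak`); this gives the generator statement.

For the extended generator, pairing with `i_ρ` of a rank-one operator between basis vectors reads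
off a matrix entry up to positive factors. Faithfulness makes `ρ^{1/4}` injective, so its
Moore–Penrose inverse is an honest inverse on its domain, dividing by `μ n` on `h n`. -/

/-! ### Basis independence and completeness of the Hilbert–Schmidt space -/

section HilbertSchmidtBasics

variable {H : Type*} [NormedAddCommGroup H] [InnerProductSpace ℂ H] {ι κ : Type*}

theorem HilbertBasis.hasSum_norm_inner_sq (h : HilbertBasis ι ℂ H) (v : H) :
    HasSum (fun n => ‖⟪h n, v⟫_ℂ‖ ^ 2) (‖v‖ ^ 2) := by
  have h1 := Complex.hasSum_re (h.hasSum_inner_mul_inner v v)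
  have h2 : (⟪v, v⟫_ℂ).re = ‖v‖ ^ 2 := by
    rw [inner_self_eq_norm_sq_to_K]; norm_cast
  rw [h2] at h1
  refine h1.congr_fun fun n => ?_
  rw [← inner_conj_symm v (h n), Complex.conj_mul']
  norm_cast

/-- Expanding each vector of a family in an orthonormal basis does not change the sum of squares. -/
theorem HilbertBasis.hasSum_prod_norm_inner_sq_iff (h : HilbertBasis ι ℂ H) (v : κ → H) (S : ℝ) :
    HasSum (fun p : κ × ι => ‖⟪h p.2, v p.1⟫_ℂ‖ ^ 2) S ↔ HasSum (fun i => ‖v i‖ ^ 2) S := by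
  have hf : ∀ i, HasSum (fun n => ‖⟪h n, v i⟫_ℂ‖ ^ 2) (‖v i‖ ^ 2) :=
    fun i => h.hasSum_norm_inner_sq (v i)
  refine ⟨fun hs => hs.prod_fiberwise hf, fun hs => ?_⟩
  have h1 : Summable (fun p : κ × ι => ‖⟪h p.2, v p.1⟫_ℂ‖ ^ 2) := by
    refine (summable_prod_of_nonneg fun p => by positivity).2 ⟨fun i => (hf i).summable, ?_⟩
    simpa only [(hf _).tsum_eq] using hs.summable
  have h2 := h1.hasSum.prod_fiberwise hf
  rw [hs.unique h2]
  exact h1.hasSum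

variable [CompleteSpace H]

/-- Both sums expand to the double sum of `‖⟪h n, a (e i)⟫‖²`. Applying this twice gives
independence of the basis. -/
theorem HilbertBasis.hasSum_norm_sq_star_iff (e : HilbertBasis κ ℂ H) (h : HilbertBasis ι ℂ H)
    (a : H →L[ℂ] H) (S : ℝ) :
    HasSum (fun i => ‖a (e i)‖ ^ 2) S ↔ HasSum (fun n => ‖(star a) (h n)‖ ^ 2) S := by
  rw [← h.hasSum_prod_norm_inner_sq_iff, ← e.hasSum_prod_norm_inner_sq_iff,
    ← (Equiv.prodComm ι κ).hasSum_iff]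
  refine iff_of_eq (congrArg (HasSum · S) (funext fun p => ?_))
  simp only [Function.comp, Equiv.prodComm_apply, Prod.fst_swap, Prod.snd_swap]
  rw [ContinuousLinearMap.star_eq_adjoint, ContinuousLinearMap.adjoint_inner_right,
    norm_inner_symm]

theorem HilbertBasis.hasSum_norm_sq_iff (e : HilbertBasis κ ℂ H) (h : HilbertBasis ι ℂ H)
    (a : H →L[ℂ] H) (S : ℝ) :
    HasSum (fun i => ‖a (e i)‖ ^ 2) S ↔ HasSum (fun n => ‖a (h n)‖ ^ 2) S := by
  rw [e.hasSum_norm_sq_star_iff h, h.hasSum_norm_sq_star_iff h, star_star]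

theorem isHilbertSchmidt_iff (h : HilbertBasis ι ℂ H) (a : H →L[ℂ] H) :
    IsHilbertSchmidt a ↔ Summable fun n => ‖a (h n)‖ ^ 2 :=
  ⟨fun ha => (((refBasis H).hasSum_norm_sq_iff h a _).1 (Summable.hasSum ha)).summable,
    fun ha => (((refBasis H).hasSum_norm_sq_iff h a _).2 ha.hasSum).summable⟩

theorem isHilbertSchmidt_iff_entries (h : HilbertBasis ι ℂ H) (a : H →L[ℂ] H) :
    IsHilbertSchmidt a ↔ Summable fun p : ι × ι => ‖⟪h p.2, a (h p.1)⟫_ℂ‖ ^ 2 :=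
  (isHilbertSchmidt_iff h a).trans
    ⟨fun ha => ((h.hasSum_prod_norm_inner_sq_iff (fun i => a (h i)) _).2 ha.hasSum).summable,
      fun ha => ((h.hasSum_prod_norm_inner_sq_iff (fun i => a (h i)) _).1 ha.hasSum).summable⟩

theorem IsHilbertSchmidt.star {a : H →L[ℂ] H} (ha : IsHilbertSchmidt a) :
    IsHilbertSchmidt (star a) :=
  (((refBasis H).hasSum_norm_sq_star_iff (refBasis H) a _).1 (Summable.hasSum ha)).summable

theorem IsHilbertSchmidt.mul_left {a : H →L[ℂ] H} (ha : IsHilbertSchmidt a) (x : H →L[ℂ] H) :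
    IsHilbertSchmidt (x * a) := by
  refine Summable.of_nonneg_of_le (fun i => by positivity) (fun i => ?_)
    (Summable.mul_left (‖x‖ ^ 2) ha)
  rw [← mul_pow]
  gcongr
  exact x.le_opNorm _

theorem IsHilbertSchmidt.mul_right {a : H →L[ℂ] H} (ha : IsHilbertSchmidt a) (x : H →L[ℂ] H) :
    IsHilbertSchmidt (a * x) := by
  simpa using (ha.star.mul_left (Star.star x)).star

theorem S2.hasSum_norm_sq (h : HilbertBasis ι ℂ H) (a : S2 H) :
    HasSum (fun n => ‖S2.toOp a (h n)‖ ^ 2) (‖a‖ ^ 2) := by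
  rw [← (refBasis H).hasSum_norm_sq_iff h]
  have h1 : (⟪a, a⟫_ℂ).re = ‖a‖ ^ 2 := by
    rw [inner_self_eq_norm_sq_to_K]; norm_cast
  have h2 : HasSum (fun i => ⟪S2.toOp a (refBasis H i), S2.toOp a (refBasis H i)⟫_ℂ) ⟪a, a⟫_ℂ :=
    (S2.summable_inner a a).hasSum
  have h3 := Complex.hasSum_re h2
  rw [h1] at h3
  refine h3.congr_fun fun n => ?_
  rw [inner_self_eq_norm_sq_to_K]; norm_cast

theorem S2.hasSum_entries (h : HilbertBasis ι ℂ H) (a : S2 H) :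
    HasSum (fun p : ι × ι => ‖⟪h p.2, S2.toOp a (h p.1)⟫_ℂ‖ ^ 2) (‖a‖ ^ 2) :=
  (h.hasSum_prod_norm_inner_sq_iff (fun i => S2.toOp a (h i)) _).2 (S2.hasSum_norm_sq h a)

/-- Polarization reduces this to the basis independence of the norm. -/
theorem S2.hasSum_inner (h : HilbertBasis ι ℂ H) (a b : S2 H) :
    HasSum (fun n => ⟪S2.toOp a (h n), S2.toOp b (h n)⟫_ℂ) ⟪a, b⟫_ℂ := by
  have key : ∀ c : S2 H, HasSum (fun n => ((‖S2.toOp c (h n)‖ : ℂ) ^ 2)) ((‖c‖ : ℂ) ^ 2) := by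
    intro c
    have := Complex.hasSum_ofReal.2 (S2.hasSum_norm_sq h c)
    simpa using this
  have h1 := ((((key (a + b)).sub (key (a - b))).add
    (((key (a - Complex.I • b)).sub (key (a + Complex.I • b))).mul_right Complex.I)).div_const 4)
  rw [inner_eq_sum_norm_sq_div_four]
  refine h1.congr_fun fun n => ?_
  rw [inner_eq_sum_norm_sq_div_four]
  simp

/-- Parseval gives `‖a v‖² = ∑ |⟪a⋆ e, v⟫|²`; apply Cauchy–Schwarz termwise. -/
theorem S2.norm_toOp_le (a : S2 H) : ‖S2.toOp a‖ ≤ ‖a‖ := by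
  refine ContinuousLinearMap.opNorm_le_bound _ (norm_nonneg _) fun v => ?_
  refine le_of_sq_le_sq ?_ (by positivity)
  have h1 := (refBasis H).hasSum_norm_inner_sq (S2.toOp a v)
  have h2 := (((refBasis H).hasSum_norm_sq_star_iff (refBasis H) _ _).1
    (S2.hasSum_norm_sq (refBasis H) a)).mul_right (‖v‖ ^ 2)
  rw [mul_pow]
  refine hasSum_le (fun i => ?_) h1 h2
  rw [← mul_pow, ContinuousLinearMap.star_eq_adjoint, ← ContinuousLinearMap.adjoint_inner_left]
  gcongr
  exact norm_inner_le_norm _ _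

/-- A Cauchy sequence has an operator-norm limit; the Cauchy estimate on finite partial sums passes
to that limit. -/
instance : CompleteSpace (S2 H) := by
  refine Metric.complete_of_cauchySeq_tendsto fun u hu => ?_
  have hsub : ∀ a b : S2 H, ‖S2.toOp a - S2.toOp b‖ ≤ ‖a - b‖ := fun a b => by
    rw [← map_sub]; exact S2.norm_toOp_le _
  have hc : CauchySeq fun k => S2.toOp (u k) := by
    rw [Metric.cauchySeq_iff] at hu ⊢
    intro ε hε
    obtain ⟨N, hN⟩ := hu ε hε
    refine ⟨N, fun m hm n hn => lt_of_le_of_lt ?_ (hN m hm n hn)⟩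
    rw [dist_eq_norm, dist_eq_norm]
    exact hsub _ _
  obtain ⟨a, ha⟩ := cauchySeq_tendsto_of_complete hc
  have key : ∀ ε > 0, ∃ N, ∀ k ≥ N, ∀ F : Finset (refIndex H),
      ∑ i ∈ F, ‖(S2.toOp (u k) - a) (refBasis H i)‖ ^ 2 ≤ ε ^ 2 := by
    intro ε hε
    obtain ⟨N, hN⟩ := Metric.cauchySeq_iff.1 hu ε hε
    refine ⟨N, fun k hk F => ?_⟩
    have hlim : Tendsto (fun l => ∑ i ∈ F, ‖(S2.toOp (u k) - S2.toOp (u l)) (refBasis H i)‖ ^ 2)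
        atTop (𝓝 (∑ i ∈ F, ‖(S2.toOp (u k) - a) (refBasis H i)‖ ^ 2)) := by
      refine tendsto_finsetSum _ fun i _ => ?_
      have h1 : Continuous fun b : H →L[ℂ] H => ‖(S2.toOp (u k) - b) (refBasis H i)‖ ^ 2 := by
        fun_prop
      exact (h1.tendsto a).comp ha
    refine le_of_tendsto hlim (eventually_atTop.2 ⟨N, fun l hl => ?_⟩)
    rw [← map_sub]
    refine (sum_le_hasSum F (fun i _ => by positivity)
      (S2.hasSum_norm_sq (refBasis H) (u k - u l))).trans ?_
    have := hN k hk l hl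
    rw [dist_eq_norm] at this
    gcongr
  have hS : ∀ k F, (∀ G : Finset (refIndex H),
      ∑ i ∈ G, ‖(S2.toOp (u k) - a) (refBasis H i)‖ ^ 2 ≤ F) →
      IsHilbertSchmidt (S2.toOp (u k) - a) := fun k F hF =>
    summable_of_sum_le (fun i => by positivity) hF
  have haHS : IsHilbertSchmidt a := by
    obtain ⟨N, hN⟩ := key 1 one_pos
    have h1 := (u N).prop.add ((hS N _ (hN N le_rfl)).smul (-1))
    simpa using h1
  refine ⟨S2.mk a haHS, ?_⟩
  rw [Metric.tendsto_atTop]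
  intro ε hε
  obtain ⟨N, hN⟩ := key (ε / 2) (by positivity)
  refine ⟨N, fun k hk => ?_⟩
  rw [dist_eq_norm]
  have h1 : ‖u k - S2.mk a haHS‖ ≤ ε / 2 := by
    refine le_of_sq_le_sq ?_ (by positivity)
    have h2 := S2.hasSum_norm_sq (refBasis H) (u k - S2.mk a haHS)
    rw [map_sub, S2.toOp_mk] at h2
    exact le_of_tendsto h2 (Eventually.of_forall fun F => hN k hk F)
  linarith

end HilbertSchmidtBasics

/-! ### Rank-one operators as trace-class test operators -/

section RankOne

variable {H : Type*} [NormedAddCommGroup H] [InnerProductSpace ℂ H] [CompleteSpace H]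

open InnerProductSpace

omit [CompleteSpace H] in
theorem rankOne_self_nonneg (u : H) : 0 ≤ rankOne ℂ u u := by
  rw [ContinuousLinearMap.nonneg_iff_isPositive]
  refine (ContinuousLinearMap.isPositive_iff_complex _).2 fun x => ?_
  rw [rankOne_apply, inner_smul_left, inner_conj_symm, ← inner_conj_symm u x,
    Complex.mul_conj', ← Complex.ofReal_pow, RCLike.re_eq_complex_re, Complex.ofReal_re]
  exact ⟨rfl, by positivity⟩

theorem rankOne_isTraceClass (v u : H) : IsTraceClass (rankOne ℂ v u) := by
  -- For `u = 0` the quotient is zero by convention and both sides vanish.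
  have habs : CFC.abs (rankOne ℂ v u) = ((‖v‖ / ‖u‖ : ℝ) : ℂ) • rankOne ℂ u u := by
    refine CFC.sqrt_unique ?_ ?_
    · by_cases hu : u = 0
      · simp [hu]
      have hu' : (‖u‖ : ℂ) ≠ 0 := by simpa using hu
      ext x
      simp [ContinuousLinearMap.star_eq_adjoint, inner_self_eq_norm_sq_to_K]
      match_scalars
      field_simp
    · exact smul_nonneg (by exact_mod_cast (by positivity)) (rankOne_self_nonneg u)
  have h1 := (((refBasis H).hasSum_inner_mul_inner u u).mul_left
    ((‖v‖ / ‖u‖ : ℝ) : ℂ))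
  refine (Complex.hasSum_re h1).summable.congr fun i => ?_
  rw [habs]
  simp

/-- This turns weak* statements into statements about matrix coefficients. -/
theorem opTrace_rankOne_mul (v u : H) (x : H →L[ℂ] H) :
    opTrace (rankOne ℂ v u * x) = ⟪u, x v⟫_ℂ := by
  have h1 := (refBasis H).hasSum_inner_mul_inner (star x u) v
  rw [ContinuousLinearMap.star_eq_adjoint, ContinuousLinearMap.adjoint_inner_left] at h1
  rw [opTrace, ← h1.tsum_eq]
  refine tsum_congr fun i => ?_
  simp [ContinuousLinearMap.adjoint_inner_left]

end RankOne

universe u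

/-! ### Compactness and eigenbases of the density operator -/

section Eigenbasis

variable {H : Type*} [NormedAddCommGroup H] [InnerProductSpace ℂ H] [CompleteSpace H] {ι : Type*}

open InnerProductSpace

/-- The finite-rank truncations `P F` converge in operator norm, the squared error being at most the
tail of the Hilbert–Schmidt sum. -/
theorem IsHilbertSchmidt.isCompactOperator {a : H →L[ℂ] H} (ha : IsHilbertSchmidt a) :
    IsCompactOperator a := by
  classical
  let P : Finset (refIndex H) → H →L[ℂ] H := fun F =>
    ∑ i ∈ F, rankOne ℂ (a (refBasis H i)) (refBasis H i)
  have hP : ∀ F, IsCompactOperator (P F) := fun F => by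
    have hmem : ∀ i, rankOne ℂ (a (refBasis H i)) (refBasis H i) ∈
        compactOperator (RingHom.id ℂ) H H := fun i => by
      change IsCompactOperator _
      have h1 : IsCompactOperator (innerSL ℂ (refBasis H i)) :=
        isCompactOperator_of_locallyCompactSpace_dom (innerSL ℂ (refBasis H i))
      exact h1.clm_comp (ContinuousLinearMap.toSpanSingleton ℂ (a (refBasis H i)))
    exact Submodule.sum_mem (compactOperator (RingHom.id ℂ) H H) fun i _ => hmem i
  have hPe : ∀ F i, (a - P F) (refBasis H i) = if i ∈ F then 0 else a (refBasis H i) := by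
    intro F i
    have hort := orthonormal_iff_ite.1 (refBasis H).orthonormal
    simp only [P, sub_apply, sum_apply, rankOne_apply,
      hort, ite_smul, one_smul, zero_smul, Finset.sum_ite_eq']
    split_ifs <;> simp
  have hbound : ∀ F, ‖a - P F‖ ^ 2 ≤
      (∑' i, ‖a (refBasis H i)‖ ^ 2) - ∑ i ∈ F, ‖a (refBasis H i)‖ ^ 2 := by
    intro F
    have h1 : HasSum (fun i => ‖(a - P F) (refBasis H i)‖ ^ 2)
        ((∑' i, ‖a (refBasis H i)‖ ^ 2) - ∑ i ∈ F, ‖a (refBasis H i)‖ ^ 2) := by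
      have h2 : HasSum (fun i => if i ∈ F then ‖a (refBasis H i)‖ ^ 2 else 0)
          (∑ i ∈ F, ‖a (refBasis H i)‖ ^ 2) := by
        have : HasSum (fun i => if i ∈ F then ‖a (refBasis H i)‖ ^ 2 else 0)
            (∑ i ∈ F, if i ∈ F then ‖a (refBasis H i)‖ ^ 2 else 0) :=
          hasSum_sum_of_ne_finset_zero fun i hi => by simp [hi]
        rwa [Finset.sum_congr rfl (g := fun i => ‖a (refBasis H i)‖ ^ 2)
          (fun i hi => by simp [hi])] at this
      refine ((Summable.hasSum ha).sub h2).congr_fun fun i => ?_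
      rw [hPe]
      split_ifs <;> simp
    have h3 := S2.norm_toOp_le (S2.mk (a - P F) h1.summable)
    have h4 := S2.hasSum_norm_sq (refBasis H) (S2.mk (a - P F) h1.summable)
    rw [h1.unique h4]
    exact pow_le_pow_left₀ (norm_nonneg _) h3 2
  have hlim : Tendsto P atTop (𝓝 a) := by
    rw [tendsto_iff_norm_sub_tendsto_zero]
    have h1 : Tendsto (fun F => (∑' i, ‖a (refBasis H i)‖ ^ 2) -
        ∑ i ∈ F, ‖a (refBasis H i)‖ ^ 2) atTop (𝓝 0) := by
      have := (Summable.hasSum ha).const_sub (∑' i, ‖a (refBasis H i)‖ ^ 2)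
      rwa [sub_self] at this
    have h2 := (squeeze_zero (fun F => by positivity) hbound h1).sqrt
    simpa [norm_sub_rev] using h2
  exact isCompactOperator_of_tendsto hlim (Eventually.of_forall hP)

/-- The spectral theorem for compact self-adjoint operators: an orthonormal basis of
eigenvectors. -/
theorem exists_hilbertBasis_eigenvectors {H : Type u} [NormedAddCommGroup H]
    [InnerProductSpace ℂ H] [CompleteSpace H] {a : H →L[ℂ] H} (ha : IsCompactOperator a)
    (hsa : (a : H →ₗ[ℂ] H).IsSymmetric) :
    ∃ (ι : Type u) (h : HilbertBasis ι ℂ H), ∀ n, ∃ c : ℂ, a (h n) = c • h n := by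
  let E : ℂ → Submodule ℂ H := fun c => Module.End.eigenspace (a : H →ₗ[ℂ] H) c
  have hE : ∀ c v, v ∈ E c ↔ a v = c • v := fun c v => Module.End.mem_eigenspace_iff
  have hfam : OrthogonalFamily ℂ (fun c => E c) fun c => (E c).subtypeₗᵢ :=
    hsa.orthogonalFamily_eigenspaces
  have hsup : (⨆ c, E c)ᗮ = ⊥ :=
    ContinuousLinearMap.orthogonalComplement_iSup_eigenspaces_eq_bot ha hsa
  clear_value E
  have : ∀ c, CompleteSpace (E c) := fun c => by
    have hcl : IsClosed (E c : Set H) := by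
      have : (E c : Set H) = {v | a v = c • v} := by
        ext v; simp [hE]
      rw [this]
      exact isClosed_eq a.continuous (by fun_prop)
    exact hcl.completeSpace_coe
  choose w b hb using fun c : ℂ => exists_hilbertBasis ℂ (E c)
  let v : (Σ c, w c) → H := fun p => (b p.1 p.2 : H)
  have hort : Orthonormal ℂ v := hfam.orthonormal_sigma_orthonormal fun c => (b c).orthonormal
  -- A vector orthogonal to a basis of each eigenspace is orthogonal to all the eigenspaces.
  have hbot : (Submodule.span ℂ (Set.range v))ᗮ = ⊥ := by
    rw [eq_bot_iff, ← hsup]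
    intro v hv
    rw [Submodule.mem_orthogonal'] at hv ⊢
    have h1 : ∀ c, E c ≤ LinearMap.ker (innerSL ℂ v).toLinearMap := by
      intro c u hu
      have hz : (innerSL ℂ v).comp (E c).subtypeL = 0 := by
        refine ContinuousLinearMap.ext_on (s := Set.range (b c)) ?_ ?_
        · rw [Submodule.dense_iff_topologicalClosure_eq_top]
          exact (b c).dense_span
        · rintro _ ⟨i, rfl⟩
          exact hv _ (Submodule.subset_span ⟨⟨c, i⟩, rfl⟩)
      exact DFunLike.congr_fun hz ⟨u, hu⟩
    intro u hu
    exact iSup_le h1 hu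
  have hv : ∀ p, ∃ c : ℂ, a (v p) = c • v p := fun p => ⟨p.1, (hE _ _).1 (b p.1 p.2).2⟩
  clear_value v
  refine ⟨_, HilbertBasis.mkOfOrthogonalEqBot hort hbot, ?_⟩
  rwa [HilbertBasis.coe_mkOfOrthogonalEqBot]

omit [CompleteSpace H] in
/-- Eigenvectors of the square of a positive operator. -/
theorem apply_eq_smul_of_sq_apply {b : H →L[ℂ] H} (hb : 0 ≤ b) {μ : ℝ} (hμ : 0 < μ) {v : H}
    (hv : b (b v) = ((μ ^ 2 : ℝ) : ℂ) • v) : b v = (μ : ℂ) • v := by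
  have hpos := (ContinuousLinearMap.nonneg_iff_isPositive b).1 hb
  rw [← sub_eq_zero]
  -- Factoring `b² - μ²` gives `b w = -μ w`, which positivity of `b` allows only for `w = 0`.
  set w := b v - (μ : ℂ) • v with hw
  have h1 : b w = -((μ : ℂ) • w) := by
    rw [hw, map_sub, map_smul, hv]
    push_cast
    module
  have h2 : 0 ≤ RCLike.re ⟪w, b w⟫_ℂ := hpos.re_inner_nonneg_right w
  rw [h1, inner_neg_right, inner_smul_right, inner_self_eq_norm_sq_to_K] at h2
  have h3 : RCLike.re (-((μ : ℂ) * (‖w‖ : ℂ) ^ 2)) = -(μ * ‖w‖ ^ 2) := by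
    rw [RCLike.re_eq_complex_re]; norm_cast
  have h4 : 0 ≤ -(μ * ‖w‖ ^ 2) := h3 ▸ h2
  have h5 : ‖w‖ ^ 2 ≤ 0 := by nlinarith [sq_nonneg ‖w‖]
  simpa using h5

variable {ρ : H →L[ℂ] H}

theorem rpow_quarter_pow_four (hρ : 0 ≤ ρ) :
    (ρ ^ (1 / 4 : ℝ) * ρ ^ (1 / 4 : ℝ)) * (ρ ^ (1 / 4 : ℝ) * ρ ^ (1 / 4 : ℝ)) = ρ := by
  have h1 : (ρ ^ (1 / 4 : ℝ)) ^ ((4 : ℕ) : ℝ) = ρ := by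
    rw [CFC.rpow_rpow_of_exponent_nonneg _ _ _ (by norm_num) (by positivity)]
    rw [show (1 / 4 : ℝ) * ((4 : ℕ) : ℝ) = 1 by norm_num]
    exact CFC.rpow_one ρ
  rw [CFC.rpow_natCast _ _ CFC.rpow_nonneg] at h1
  conv_rhs => rw [← h1]
  noncomm_ring

theorem inner_rpow_quarter (u v : H) :
    ⟪(ρ ^ (1 / 4 : ℝ)) u, v⟫_ℂ = ⟪u, (ρ ^ (1 / 4 : ℝ)) v⟫_ℂ := by
  have h : (ρ ^ (1 / 4 : ℝ)).IsPositive :=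
    (ContinuousLinearMap.nonneg_iff_isPositive _).1 CFC.rpow_nonneg
  exact h.isSymmetric u v

/-- Faithfulness is tested on the rank-one operator of `v`, whose product with `ρ` vanishes. -/
theorem IsFaithfulNormalState.eq_zero_of_apply_eq_zero (hρ : IsFaithfulNormalState ρ) {v : H}
    (hv : ρ v = 0) : v = 0 := by
  by_contra hne
  have h1 := hρ.faithful (rankOne ℂ v v) (rankOne_self_nonneg v) (rankOne_ne_zero hne hne)
  have h2 : ρ * rankOne ℂ v v = 0 := by
    ext x; simp [hv]
  rw [normalFunctional, h2] at h1
  simp [opTrace] at h1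

/-- `h` consists of eigenvectors of `ρ^{1/4}` with the positive eigenvalues `μ`. -/
structure IsQuarterEigenbasis (ρ : H →L[ℂ] H) (h : HilbertBasis ι ℂ H) (μ : ι → ℝ) : Prop where
  pos : ∀ n, 0 < μ n
  apply : ∀ n, (ρ ^ (1 / 4 : ℝ)) (h n) = (μ n : ℂ) • h n

theorem IsFaithfulNormalState.exists_isQuarterEigenbasis (hρ : IsFaithfulNormalState ρ)
    (h : HilbertBasis ι ℂ H) (hh : ∀ n, ∃ c : ℂ, ρ (h n) = c • h n) :
    ∃ μ, IsQuarterEigenbasis ρ h μ := by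
  have key : ∀ n, ∃ l : ℝ, 0 < l ∧ (ρ ^ (1 / 4 : ℝ)) (h n) = (l : ℂ) • h n := by
    intro n
    obtain ⟨c, hc⟩ := hh n
    have hpos := (ContinuousLinearMap.nonneg_iff_isPositive ρ).1 hρ.nonneg
    have hn : ‖h n‖ = 1 := h.orthonormal.1 n
    have hc0 : 0 ≤ c := by
      have h1 := hpos.inner_nonneg_right (h n)
      rw [hc, inner_smul_right, inner_self_eq_norm_sq_to_K, hn] at h1
      simpa using h1
    have hcne : c ≠ 0 := by
      rintro rfl
      have h1 := hρ.eq_zero_of_apply_eq_zero (v := h n) (by simpa using hc)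
      simp [h1] at hn
    obtain ⟨r, hr, rfl⟩ : ∃ r : ℝ, 0 < r ∧ (r : ℂ) = c := by
      have h1 := Complex.pos_iff.1 (lt_of_le_of_ne hc0 hcne.symm)
      exact ⟨c.re, h1.1, Complex.ext rfl h1.2⟩
    set k := ρ ^ (1 / 4 : ℝ) with hk
    have hk0 : 0 ≤ k := CFC.rpow_nonneg
    have hkk : 0 ≤ k * k := by
      have := star_mul_self_nonneg k
      rwa [(IsSelfAdjoint.of_nonneg hk0).star_eq] at this
    -- Square roots are taken twice: from `ρ` to `k * k`, then from `k * k` to `k`.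
    refine ⟨√(√r), by positivity, ?_⟩
    have h2 : (k * k) (h n) = ((√r : ℝ) : ℂ) • h n := by
      refine apply_eq_smul_of_sq_apply hkk (by positivity) ?_
      rw [← mul_apply_eq_comp, rpow_quarter_pow_four hρ.nonneg, hc,
        Real.sq_sqrt hr.le]
    refine apply_eq_smul_of_sq_apply hk0 (by positivity) ?_
    rw [Real.sq_sqrt (by positivity)]
    exact h2
  choose μ h1 h2 using key
  exact ⟨μ, h1, h2⟩

/-- Because `‖ρ^{1/2} e‖² = ⟪e, ρ e⟫` and `|ρ| = ρ`. -/
theorem IsFaithfulNormalState.isHilbertSchmidt_sqrt (hρ : IsFaithfulNormalState ρ) :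
    IsHilbertSchmidt (ρ ^ (1 / 4 : ℝ) * ρ ^ (1 / 4 : ℝ)) := by
  have h1 := hρ.traceClass
  rw [IsTraceClass, CFC.abs_of_nonneg ρ hρ.nonneg] at h1
  refine h1.congr fun i => ?_
  have h2 : ∀ v, ‖(ρ ^ (1 / 4 : ℝ) * ρ ^ (1 / 4 : ℝ)) v‖ ^ 2 = (⟪v, ρ v⟫_ℂ).re := by
    intro v
    conv_rhs => rw [← rpow_quarter_pow_four hρ.nonneg]
    rw [mul_apply_eq_comp, mul_apply_eq_comp,
      mul_apply_eq_comp, mul_apply_eq_comp, ← inner_rpow_quarter, ← inner_rpow_quarter,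
      inner_self_eq_norm_sq_to_K]
    norm_cast
  exact (h2 _).symm

theorem IsFaithfulNormalState.exists_eigenbasis {H : Type u} [NormedAddCommGroup H]
    [InnerProductSpace ℂ H] [CompleteSpace H] {ρ : H →L[ℂ] H} (hρ : IsFaithfulNormalState ρ) :
    ∃ (ι : Type u) (h : HilbertBasis ι ℂ H) (μ : ι → ℝ), IsQuarterEigenbasis ρ h μ := by
  have hc : IsCompactOperator ρ := by
    have := hρ.isHilbertSchmidt_sqrt.mul_left (ρ ^ (1 / 4 : ℝ) * ρ ^ (1 / 4 : ℝ))
    rw [rpow_quarter_pow_four hρ.nonneg] at this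
    exact this.isCompactOperator
  obtain ⟨ι, h, hh⟩ := exists_hilbertBasis_eigenvectors hc
    ((ContinuousLinearMap.nonneg_iff_isPositive ρ).1 hρ.nonneg).isSymmetric
  exact ⟨ι, h, hρ.exists_isQuarterEigenbasis h hh⟩

end Eigenbasis

/-! ### Interpolation between weighted `ℓ²` norms -/

section Interpolation

/-- Interpolation by the spectral radius: if `T` and `D² T D⁻²` are contractions, with `D`
self-adjoint and invertible, then so is `D T D⁻¹`. -/
theorem CStarAlgebra.norm_conj_le_one {A : Type*} [CStarAlgebra A] (D : Aˣ)
    (hD : IsSelfAdjoint (D : A)) (T : A) (h0 : ‖T‖ ≤ 1)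
    (h1 : ‖(D : A) * D * T * (↑D⁻¹ * ↑D⁻¹)‖ ≤ 1) : ‖(D : A) * T * ↑D⁻¹‖ ≤ 1 := by
  rcases subsingleton_or_nontrivial A with hA | hA
  · rw [Subsingleton.elim ((D : A) * T * ↑D⁻¹) 0, norm_zero]
    exact zero_le_one
  have hD' : star (↑D⁻¹ : A) = ↑D⁻¹ := by
    have h2 : star D = D := Units.ext hD.star_eq
    rw [← Units.coe_star_inv, h2]
  set B : A := (D : A) * T * ↑D⁻¹ with hB
  -- The key identity: `B⋆B` is similar to a product of two contractions, so its spectral radius is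
  -- at most one; being self-adjoint, it has norm equal to that radius.
  have h2 : (D : A) * (star B * B) * ↑D⁻¹ = star T * ((D : A) * D * T * (↑D⁻¹ * ↑D⁻¹)) := by
    rw [hB, star_mul, star_mul, hD', hD.star_eq]
    simp only [← mul_assoc, Units.mul_inv, one_mul]
  have h3 : spectralRadius ℂ (star B * B) ≤ 1 := by
    have h4 : spectralRadius ℂ (star B * B) = spectralRadius ℂ ((D : A) * (star B * B) * ↑D⁻¹) := by
      rw [spectralRadius, spectralRadius, spectrum.units_conjugate]
    rw [h4, h2]
    refine (spectrum.spectralRadius_le_nnnorm _).trans ?_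
    have h5 : ‖star T * ((D : A) * D * T * (↑D⁻¹ * ↑D⁻¹))‖ ≤ 1 :=
      (norm_mul_le _ _).trans (mul_le_one₀ (by rwa [norm_star]) (norm_nonneg _) h1)
    exact_mod_cast h5
  rw [(IsSelfAdjoint.star_mul_self B).spectralRadius_eq_nnnorm] at h3
  have h6 : ‖star B * B‖ ≤ 1 := by exact_mod_cast h3
  rw [CStarRing.norm_star_mul_self] at h6
  nlinarith [norm_nonneg B]

variable {κ : Type*} [Fintype κ]

/-- The diagonal operator on `ℓ²` of a finite set. -/
noncomputable def diagonalCLM (w : κ → ℝ) : EuclideanSpace ℂ κ →L[ℂ] EuclideanSpace ℂ κ :=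
  LinearMap.toContinuousLinearMap
    { toFun := fun v => WithLp.toLp 2 fun i => (w i : ℂ) * v i
      map_add' := fun u v => by ext i; simp [mul_add]
      map_smul' := fun c v => by ext i; simp [mul_left_comm] }

@[simp]
theorem diagonalCLM_apply (w : κ → ℝ) (v : EuclideanSpace ℂ κ) (i : κ) :
    diagonalCLM w v i = w i * v i := rfl

theorem diagonalCLM_mul (w w' : κ → ℝ) :
    diagonalCLM w * diagonalCLM w' = diagonalCLM fun i => w i * w' i := by
  ext v i; simp [mul_assoc]

theorem isSelfAdjoint_diagonalCLM (w : κ → ℝ) : IsSelfAdjoint (diagonalCLM w) := by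
  rw [ContinuousLinearMap.isSelfAdjoint_iff_isSymmetric]
  intro u v
  simp only [PiLp.inner_apply, ContinuousLinearMap.coe_coe, diagonalCLM_apply]
  refine Finset.sum_congr rfl fun i _ => ?_
  simp [mul_left_comm, mul_assoc]

/-- The substitution `v = w c` identifies the weighted norm of `c` with the plain norm of `v`. -/
theorem norm_diagonalCLM_conj_le_one_iff {w : κ → ℝ} (hw : ∀ i, 0 < w i)
    (S : EuclideanSpace ℂ κ →L[ℂ] EuclideanSpace ℂ κ) :
    ‖diagonalCLM w * S * diagonalCLM (fun i => (w i)⁻¹)‖ ≤ 1 ↔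
      ∀ c, ∑ i, w i ^ 2 * ‖S c i‖ ^ 2 ≤ ∑ i, w i ^ 2 * ‖c i‖ ^ 2 := by
  have hn : ∀ v, ‖diagonalCLM w v‖ ^ 2 = ∑ i, w i ^ 2 * ‖v i‖ ^ 2 := fun v => by
    rw [EuclideanSpace.norm_sq_eq]
    simp [mul_pow]
  have hinv : ∀ v, diagonalCLM (fun i => (w i)⁻¹) (diagonalCLM w v) = v := fun v => by
    ext i
    have : (w i : ℂ) ≠ 0 := by exact_mod_cast (hw i).ne'
    simp [this]
  have hinv' : ∀ v, diagonalCLM w (diagonalCLM (fun i => (w i)⁻¹) v) = v := fun v => by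
    ext i
    have : (w i : ℂ) ≠ 0 := by exact_mod_cast (hw i).ne'
    simp [this]
  constructor
  · intro h c
    rw [← hn, ← hn]
    have h1 := ContinuousLinearMap.le_of_opNorm_le _ h (diagonalCLM w c)
    rw [mul_apply_eq_comp, mul_apply_eq_comp, hinv, one_mul] at h1
    gcongr
  · intro h
    refine ContinuousLinearMap.opNorm_le_bound _ zero_le_one fun v => ?_
    rw [one_mul]
    refine le_of_sq_le_sq ?_ (norm_nonneg _)
    rw [mul_apply_eq_comp, mul_apply_eq_comp, hn]
    conv_rhs => rw [← hinv' v, hn]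
    exact h _

/-- Interpolation of weighted `ℓ²` contractions on a finite set: the middle weight is the
geometric mean of the outer ones. -/
theorem sum_weight_le_of_interpolation {α δ : κ → ℝ} (hα : ∀ i, 0 < α i) (hδ : ∀ i, 0 < δ i)
    (S : EuclideanSpace ℂ κ →L[ℂ] EuclideanSpace ℂ κ)
    (h0 : ∀ c, ∑ i, α i ^ 2 * ‖S c i‖ ^ 2 ≤ ∑ i, α i ^ 2 * ‖c i‖ ^ 2)
    (h1 : ∀ c, ∑ i, (δ i * δ i * α i) ^ 2 * ‖S c i‖ ^ 2 ≤
      ∑ i, (δ i * δ i * α i) ^ 2 * ‖c i‖ ^ 2) (c : EuclideanSpace ℂ κ) :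
    ∑ i, (δ i * α i) ^ 2 * ‖S c i‖ ^ 2 ≤ ∑ i, (δ i * α i) ^ 2 * ‖c i‖ ^ 2 := by
  have hone : ∀ w w' : κ → ℝ, (∀ i, w i * w' i = 1) → diagonalCLM w * diagonalCLM w' = 1 := by
    intro w w' h
    rw [diagonalCLM_mul]
    ext v i
    simp [h]
  let D : (EuclideanSpace ℂ κ →L[ℂ] EuclideanSpace ℂ κ)ˣ :=
    ⟨diagonalCLM δ, diagonalCLM fun i => (δ i)⁻¹,
      hone _ _ fun i => mul_inv_cancel₀ (hδ i).ne', hone _ _ fun i => inv_mul_cancel₀ (hδ i).ne'⟩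
  have e1 : (D : EuclideanSpace ℂ κ →L[ℂ] EuclideanSpace ℂ κ) * D *
      (diagonalCLM α * S * diagonalCLM fun i => (α i)⁻¹) * (↑D⁻¹ * ↑D⁻¹) =
      diagonalCLM (fun i => δ i * δ i * α i) * S *
        diagonalCLM fun i => (δ i * δ i * α i)⁻¹ := by
    change diagonalCLM δ * diagonalCLM δ * (diagonalCLM α * S * diagonalCLM _) *
      (diagonalCLM _ * diagonalCLM _) = _
    rw [diagonalCLM_mul, diagonalCLM_mul, ← mul_assoc, ← mul_assoc, diagonalCLM_mul, mul_assoc,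
      diagonalCLM_mul]
    congr 2
    funext i
    rw [mul_inv, mul_inv]
    ring
  have e2 : (D : EuclideanSpace ℂ κ →L[ℂ] EuclideanSpace ℂ κ) *
      (diagonalCLM α * S * diagonalCLM fun i => (α i)⁻¹) * ↑D⁻¹ =
      diagonalCLM (fun i => δ i * α i) * S * diagonalCLM fun i => (δ i * α i)⁻¹ := by
    change diagonalCLM δ * (diagonalCLM α * S * diagonalCLM _) * diagonalCLM _ = _
    rw [← mul_assoc, ← mul_assoc, diagonalCLM_mul, mul_assoc _ (diagonalCLM _) (diagonalCLM _),
      diagonalCLM_mul]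
    congr 2
    funext i
    rw [mul_inv, mul_comm]
  -- Conjugating by `α` first makes the three weights `α`, `δα`, `δ²α` correspond to conjugation by
  -- `1`, `D`, `D²`.
  have h2 := CStarAlgebra.norm_conj_le_one D (isSelfAdjoint_diagonalCLM δ)
    (diagonalCLM α * S * diagonalCLM fun i => (α i)⁻¹)
    ((norm_diagonalCLM_conj_le_one_iff hα S).2 h0) (by
      rw [e1]
      exact (norm_diagonalCLM_conj_le_one_iff
        (fun i => mul_pos (mul_pos (hδ i) (hδ i)) (hα i)) S).2 h1)
  rw [e2] at h2
  exact (norm_diagonalCLM_conj_le_one_iff (fun i => mul_pos (hδ i) (hα i)) S).1 h2 c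

end Interpolation

/-! ### Weighted entry sums and the contraction estimate -/

section NormalState

variable {H : Type*} [NormedAddCommGroup H] [InnerProductSpace ℂ H] [CompleteSpace H] {ι : Type*}
  {ρ : H →L[ℂ] H} {h : HilbertBasis ι ℂ H} {μ : ι → ℝ}

theorem IsQuarterEigenbasis.apply_sq (hb : IsQuarterEigenbasis ρ h μ) (n : ι) :
    (ρ ^ (1 / 4 : ℝ) * ρ ^ (1 / 4 : ℝ)) (h n) = ((μ n ^ 2 : ℝ) : ℂ) • h n := by
  rw [mul_apply_eq_comp, hb.apply, map_smul, hb.apply, smul_smul]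
  push_cast
  ring_nf

/-- `Tr (ρ x)` is the Hilbert–Schmidt inner product of `ρ^{1/2}` and `ρ^{1/2} x`, so it may be
evaluated in the eigenbasis. -/
theorem hasSum_normalFunctional (hρ : IsFaithfulNormalState ρ) (hb : IsQuarterEigenbasis ρ h μ)
    (x : H →L[ℂ] H) :
    HasSum (fun n => ((μ n ^ 4 : ℝ) : ℂ) * ⟪h n, x (h n)⟫_ℂ) (normalFunctional ρ x) := by
  have hs : IsHilbertSchmidt (ρ ^ (1 / 4 : ℝ) * ρ ^ (1 / 4 : ℝ)) := hρ.isHilbertSchmidt_sqrt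
  have hsym : ∀ u v, ⟪(ρ ^ (1 / 4 : ℝ) * ρ ^ (1 / 4 : ℝ)) u, v⟫_ℂ =
      ⟪u, (ρ ^ (1 / 4 : ℝ) * ρ ^ (1 / 4 : ℝ)) v⟫_ℂ := fun u v => by
    rw [mul_apply_eq_comp, mul_apply_eq_comp, inner_rpow_quarter, inner_rpow_quarter]
  have h1 := S2.hasSum_inner h (S2.mk _ hs) (S2.mk _ (hs.mul_right x))
  have h2 : normalFunctional ρ x = ⟪S2.mk _ hs, S2.mk _ (hs.mul_right x)⟫_ℂ := by
    refine tsum_congr fun i => ?_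
    rw [S2.toOp_mk, S2.toOp_mk, hsym, ← mul_apply_eq_comp, ← mul_assoc,
      rpow_quarter_pow_four hρ.nonneg]
  rw [h2]
  refine h1.congr_fun fun n => ?_
  rw [S2.toOp_mk, S2.toOp_mk, mul_apply_eq_comp _ x, hb.apply_sq, ← hsym, map_smul, hb.apply_sq,
    smul_smul, ← Complex.ofReal_mul, inner_smul_left, Complex.conj_ofReal]
  ring_nf

/-- The GNS form `ω_ρ(x⋆ x)`. -/
noncomputable def gnsForm (ρ x : H →L[ℂ] H) : ℝ := (normalFunctional ρ (star x * x)).re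

theorem hasSum_gnsForm (hρ : IsFaithfulNormalState ρ) (hb : IsQuarterEigenbasis ρ h μ)
    (x : H →L[ℂ] H) : HasSum (fun n => μ n ^ 4 * ‖x (h n)‖ ^ 2) (gnsForm ρ x) := by
  refine (Complex.hasSum_re (hasSum_normalFunctional hρ hb (star x * x))).congr_fun fun n => ?_
  rw [Complex.re_ofReal_mul, mul_apply_eq_comp, ContinuousLinearMap.star_eq_adjoint,
    ContinuousLinearMap.adjoint_inner_right, inner_self_eq_norm_sq_to_K]
  norm_cast

theorem hasSum_gnsForm_entries (hρ : IsFaithfulNormalState ρ) (hb : IsQuarterEigenbasis ρ h μ)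
    (x : H →L[ℂ] H) :
    HasSum (fun p : ι × ι => μ p.1 ^ 4 * ‖⟪h p.2, x (h p.1)⟫_ℂ‖ ^ 2) (gnsForm ρ x) := by
  have h1 : HasSum (fun n => ‖((μ n ^ 2 : ℝ) : ℂ) • x (h n)‖ ^ 2) (gnsForm ρ x) := by
    refine (hasSum_gnsForm hρ hb x).congr_fun fun n => ?_
    rw [norm_smul, mul_pow, Complex.norm_real, Real.norm_eq_abs, sq_abs]
    ring
  refine ((h.hasSum_prod_norm_inner_sq_iff _ _).2 h1).congr_fun fun p => ?_
  rw [inner_smul_right, norm_mul, mul_pow, Complex.norm_real, Real.norm_eq_abs, sq_abs]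
  ring

/-- Taking adjoints moves the weight from the column index `p.1` to the row index `p.2`. -/
theorem hasSum_gnsForm_star_entries (hρ : IsFaithfulNormalState ρ)
    (hb : IsQuarterEigenbasis ρ h μ) (x : H →L[ℂ] H) :
    HasSum (fun p : ι × ι => μ p.2 ^ 4 * ‖⟪h p.2, x (h p.1)⟫_ℂ‖ ^ 2) (gnsForm ρ (star x)) := by
  rw [← (Equiv.prodComm ι ι).hasSum_iff]
  refine (hasSum_gnsForm_entries hρ hb (star x)).congr_fun fun p => ?_
  simp only [Function.comp, Equiv.prodComm_apply, Prod.fst_swap, Prod.snd_swap]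
  rw [ContinuousLinearMap.star_eq_adjoint, ContinuousLinearMap.adjoint_inner_right,
    norm_inner_symm]

theorem re_normalFunctional_mono (hρ : IsFaithfulNormalState ρ) {a b : H →L[ℂ] H} (hab : a ≤ b) :
    (normalFunctional ρ a).re ≤ (normalFunctional ρ b).re := by
  obtain ⟨ι, h, μ, hb⟩ := hρ.exists_eigenbasis
  refine hasSum_le (fun n => ?_) (Complex.hasSum_re (hasSum_normalFunctional hρ hb a))
    (Complex.hasSum_re (hasSum_normalFunctional hρ hb b))
  have h1 : (b - a).IsPositive := (ContinuousLinearMap.nonneg_iff_isPositive _).1 (sub_nonneg.2 hab)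
  have h2 : 0 ≤ (⟪h n, (b - a) (h n)⟫_ℂ).re := h1.re_inner_nonneg_right (h n)
  rw [sub_apply, inner_sub_right, Complex.sub_re, sub_nonneg] at h2
  rw [Complex.re_ofReal_mul, Complex.re_ofReal_mul]
  have := hb.pos n
  gcongr

theorem gnsForm_le_of_isSchwarzMap (hρ : IsFaithfulNormalState ρ)
    {T : (H →L[ℂ] H) →L[ℂ] (H →L[ℂ] H)} (hT : IsSchwarzMap T) (hsub : IsSubinvariant ρ T)
    (x : H →L[ℂ] H) : gnsForm ρ (T x) ≤ gnsForm ρ x :=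
  (re_normalFunctional_mono hρ (hT x)).trans
    (Complex.le_def.1 (hsub _ (star_mul_self_nonneg x))).1

/-- The Schwarz inequality makes `T` positive, and positive maps preserve adjoints. This supplies
the second endpoint of the interpolation. -/
theorem IsSchwarzMap.map_star {T : (H →L[ℂ] H) →L[ℂ] (H →L[ℂ] H)} (hT : IsSchwarzMap T)
    (x : H →L[ℂ] H) : T (star x) = star (T x) := by
  have hpos : ∀ a, 0 ≤ a → 0 ≤ T a := fun a ha => by
    obtain ⟨b, rfl⟩ := CStarAlgebra.nonneg_iff_eq_star_mul_self.1 ha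
    exact (star_mul_self_nonneg _).trans (hT b)
  let f : (H →L[ℂ] H) →ₚ[ℂ] (H →L[ℂ] H) := PositiveLinearMap.mk₀ (T : _ →ₗ[ℂ] _) hpos
  exact StarHomClass.map_star f x

theorem iRho_entry (hb : IsQuarterEigenbasis ρ h μ) (x : H →L[ℂ] H) (n m : ι) :
    ⟪h n, iRho ρ x (h m)⟫_ℂ = ((μ n * μ m : ℝ) : ℂ) * ⟪h n, x (h m)⟫_ℂ := by
  rw [iRho, mul_apply_eq_comp, mul_apply_eq_comp, ← inner_rpow_quarter, hb.apply, hb.apply,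
    map_smul, inner_smul_left, inner_smul_right, Complex.conj_ofReal]
  push_cast
  ring

theorem norm_iRho_entry_sq (hb : IsQuarterEigenbasis ρ h μ) (x : H →L[ℂ] H) (p : ι × ι) :
    ‖⟪h p.2, iRho ρ x (h p.1)⟫_ℂ‖ ^ 2 =
      (μ p.2 * μ p.1) ^ 2 * ‖⟪h p.2, x (h p.1)⟫_ℂ‖ ^ 2 := by
  rw [iRho_entry hb, norm_mul, mul_pow, Complex.norm_real, Real.norm_eq_abs, sq_abs]

/-- By `μ_row² μ_col² ≤ μ_row⁴ + μ_col⁴` the sum is dominated by the two GNS sums. -/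
theorem IsFaithfulNormalState.isHilbertSchmidt_iRho (hρ : IsFaithfulNormalState ρ)
    (x : H →L[ℂ] H) : IsHilbertSchmidt (iRho ρ x) := by
  obtain ⟨ι, h, μ, hb⟩ := hρ.exists_eigenbasis
  rw [isHilbertSchmidt_iff_entries h]
  refine Summable.of_nonneg_of_le (fun p => by positivity) (fun p => ?_)
    ((hasSum_gnsForm_entries hρ hb x).add (hasSum_gnsForm_star_entries hρ hb x)).summable
  rw [norm_iRho_entry_sq hb, ← add_mul]
  gcongr
  nlinarith [sq_nonneg (μ p.1 ^ 2 - μ p.2 ^ 2), sq_nonneg (μ p.1 ^ 2), sq_nonneg (μ p.2 ^ 2)]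

/-- The operator whose matrix in the basis `h` has the entries `c` on `K` and vanishes
elsewhere. -/
noncomputable def ofEntries (h : HilbertBasis ι ℂ H) (K : Finset (ι × ι)) (c : EuclideanSpace ℂ K) :
    H →L[ℂ] H :=
  ∑ p : K, c p • InnerProductSpace.rankOne ℂ (h p.1.2) (h p.1.1)

omit [CompleteSpace H] in
theorem ofEntries_entry [DecidableEq ι] (h : HilbertBasis ι ℂ H) (K : Finset (ι × ι))
    (c : EuclideanSpace ℂ K) (q : ι × ι) :
    ⟪h q.2, ofEntries h K c (h q.1)⟫_ℂ = if hq : q ∈ K then c ⟨q, hq⟩ else 0 := by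
  have hort := orthonormal_iff_ite.1 h.orthonormal
  have h1 : ∀ p : K, ⟪h q.2, (c p • InnerProductSpace.rankOne ℂ (h p.1.2) (h p.1.1)) (h q.1)⟫_ℂ =
      if p.1 = q then c p else 0 := by
    intro p
    rw [smul_apply, InnerProductSpace.rankOne_apply, inner_smul_right, inner_smul_right, hort, hort]
    by_cases e : p.1 = q
    · simp [e]
    · rw [if_neg e]
      by_cases e1 : p.1.1 = q.1
      · have e2 : q.2 ≠ p.1.2 := fun e2 => e (Prod.ext e1 e2.symm)
        simp [e2]
      · simp [e1]
  rw [ofEntries, sum_apply, inner_sum]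
  simp only [h1]
  split_ifs with hq
  · rw [Finset.sum_eq_single ⟨q, hq⟩]
    · simp
    · intro p _ hp
      exact if_neg fun e => hp (Subtype.ext e)
    · simp
  · refine Finset.sum_eq_zero fun p _ => if_neg fun e : p.1 = q => hq (e ▸ p.2)

theorem gnsForm_ofEntries (hρ : IsFaithfulNormalState ρ) (hb : IsQuarterEigenbasis ρ h μ)
    (K : Finset (ι × ι)) (c : EuclideanSpace ℂ K) :
    gnsForm ρ (ofEntries h K c) = ∑ p : K, μ p.1.1 ^ 4 * ‖c p‖ ^ 2 := by
  classical
  refine (hasSum_gnsForm_entries hρ hb _).unique ?_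
  have h1 : ∀ p : ι × ι, p ∉ K →
      μ p.1 ^ 4 * ‖⟪h p.2, ofEntries h K c (h p.1)⟫_ℂ‖ ^ 2 = 0 := fun p hp => by
    rw [ofEntries_entry, dif_neg hp]; simp
  have h2 : HasSum _ (∑ p ∈ K, μ p.1 ^ 4 * ‖⟪h p.2, ofEntries h K c (h p.1)⟫_ℂ‖ ^ 2) :=
    hasSum_sum_of_ne_finset_zero h1
  convert h2 using 1
  rw [← Finset.sum_coe_sort K]
  refine Finset.sum_congr rfl fun p _ => ?_
  rw [ofEntries_entry, dif_pos p.2]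

theorem gnsForm_star_ofEntries (hρ : IsFaithfulNormalState ρ) (hb : IsQuarterEigenbasis ρ h μ)
    (K : Finset (ι × ι)) (c : EuclideanSpace ℂ K) :
    gnsForm ρ (star (ofEntries h K c)) = ∑ p : K, μ p.1.2 ^ 4 * ‖c p‖ ^ 2 := by
  classical
  refine (hasSum_gnsForm_star_entries hρ hb _).unique ?_
  have h1 : ∀ p : ι × ι, p ∉ K →
      μ p.2 ^ 4 * ‖⟪h p.2, ofEntries h K c (h p.1)⟫_ℂ‖ ^ 2 = 0 := fun p hp => by
    rw [ofEntries_entry, dif_neg hp]; simp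
  have h2 : HasSum _ (∑ p ∈ K, μ p.2 ^ 4 * ‖⟪h p.2, ofEntries h K c (h p.1)⟫_ℂ‖ ^ 2) :=
    hasSum_sum_of_ne_finset_zero h1
  convert h2 using 1
  rw [← Finset.sum_coe_sort K]
  refine Finset.sum_congr rfl fun p _ => ?_
  rw [ofEntries_entry, dif_pos p.2]

/-- A Schwarz map with a subinvariant faithful normal state contracts the Hilbert–Schmidt norm of
`i_ρ(x)`, for `x` with finitely many matrix entries. -/
theorem sum_entries_map_ofEntries_le (hρ : IsFaithfulNormalState ρ)
    (hb : IsQuarterEigenbasis ρ h μ) {T : (H →L[ℂ] H) →L[ℂ] (H →L[ℂ] H)} (hT : IsSchwarzMap T)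
    (hsub : IsSubinvariant ρ T) (K : Finset (ι × ι)) (c : EuclideanSpace ℂ K) :
    ∑ p : K, (μ p.1.2 * μ p.1.1) ^ 2 * ‖⟪h p.1.2, T (ofEntries h K c) (h p.1.1)⟫_ℂ‖ ^ 2 ≤
      ∑ p : K, (μ p.1.2 * μ p.1.1) ^ 2 * ‖c p‖ ^ 2 := by
  -- The compression of `T` to the entries in `K`; discarding the other output entries only
  -- decreases the weighted sums.
  let S : EuclideanSpace ℂ K →L[ℂ] EuclideanSpace ℂ K := LinearMap.toContinuousLinearMap
    { toFun := fun c => WithLp.toLp 2 fun p => ⟪h p.1.2, T (ofEntries h K c) (h p.1.1)⟫_ℂ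
      map_add' := fun c d => by
        ext p; simp [ofEntries, add_smul, Finset.sum_add_distrib]
      map_smul' := fun r c => by
        ext p; simp [ofEntries, mul_smul, ← Finset.smul_sum] }
  have hS : ∀ c p, S c p = ⟪h p.1.2, T (ofEntries h K c) (h p.1.1)⟫_ℂ := fun c p => rfl
  have hμ : ∀ p : K, (μ p.1.2 / μ p.1.1) * μ p.1.1 ^ 2 = μ p.1.2 * μ p.1.1 := fun p => by
    have := (hb.pos p.1.1).ne'
    field_simp
  have hμ' : ∀ p : K, (μ p.1.2 / μ p.1.1) * (μ p.1.2 / μ p.1.1) * μ p.1.1 ^ 2 = μ p.1.2 ^ 2 :=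
    fun p => by
      have := (hb.pos p.1.1).ne'
      field_simp
  -- With this `α` and `δ` the weights `α`, `δα`, `δ²α` are `μ_col²`, `μ_row μ_col`, `μ_row²`.
  have h1 := sum_weight_le_of_interpolation (α := fun p : K => μ p.1.1 ^ 2)
    (δ := fun p : K => μ p.1.2 / μ p.1.1) (fun p => pow_pos (hb.pos _) 2)
    (fun p => div_pos (hb.pos _) (hb.pos _)) S ?_ ?_ c
  · simpa only [hμ, hS] using h1
  · intro c
    have h2 := (sum_le_hasSum (K : Finset (ι × ι)) (fun p _ => by positivity)
      (hasSum_gnsForm_entries hρ hb (T (ofEntries h K c)))).trans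
      (gnsForm_le_of_isSchwarzMap hρ hT hsub _)
    rw [gnsForm_ofEntries hρ hb, ← Finset.sum_coe_sort K] at h2
    simpa only [← pow_mul, hS] using h2
  · intro c
    have h2 := (sum_le_hasSum (K : Finset (ι × ι)) (fun p _ => by positivity)
      (hasSum_gnsForm_star_entries hρ hb (T (ofEntries h K c)))).trans
      ((hT.map_star _ ▸ gnsForm_le_of_isSchwarzMap hρ hT hsub (star (ofEntries h K c))))
    rw [gnsForm_star_ofEntries hρ hb, ← Finset.sum_coe_sort K] at h2
    simpa only [hμ', ← pow_mul, hS] using h2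

/-- A Schwarz map with a subinvariant faithful normal state contracts the Hilbert–Schmidt norm of
`i_ρ(x)`. -/
theorem norm_iRho_map_le (hρ : IsFaithfulNormalState ρ) {T : (H →L[ℂ] H) →L[ℂ] (H →L[ℂ] H)}
    (hT : IsSchwarzMap T) (hsub : IsSubinvariant ρ T) (x : H →L[ℂ] H) :
    ‖S2.mk (iRho ρ (T x)) (hρ.isHilbertSchmidt_iRho _)‖ ≤
      ‖S2.mk (iRho ρ x) (hρ.isHilbertSchmidt_iRho x)‖ := by
  classical
  obtain ⟨ι, h, μ, hb⟩ := hρ.exists_eigenbasis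
  have hentry : ∀ y, HasSum (fun p : ι × ι => (μ p.2 * μ p.1) ^ 2 * ‖⟪h p.2, y (h p.1)⟫_ℂ‖ ^ 2)
      (‖S2.mk (iRho ρ y) (hρ.isHilbertSchmidt_iRho y)‖ ^ 2) := fun y =>
    (S2.hasSum_entries h (S2.mk _ (hρ.isHilbertSchmidt_iRho y))).congr_fun fun p =>
      (norm_iRho_entry_sq hb y p).symm
  let X : Finset (ι × ι) → H →L[ℂ] H := fun K =>
    ofEntries h K (WithLp.toLp 2 fun p => ⟪h p.1.2, x (h p.1.1)⟫_ℂ)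
  have hX : ∀ K (q : ι × ι), ⟪h q.2, X K (h q.1)⟫_ℂ = if q ∈ K then ⟪h q.2, x (h q.1)⟫_ℂ else 0 :=
    fun K q => by
      rw [ofEntries_entry]
      split_ifs <;> rfl
  have hgns : ∀ K, gnsForm ρ (X K - x) =
      gnsForm ρ x - ∑ p ∈ K, μ p.1 ^ 4 * ‖⟪h p.2, x (h p.1)⟫_ℂ‖ ^ 2 := by
    intro K
    have h2 : HasSum (fun p : ι × ι => if p ∈ K then μ p.1 ^ 4 * ‖⟪h p.2, x (h p.1)⟫_ℂ‖ ^ 2 else 0)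
        (∑ p ∈ K, if p ∈ K then μ p.1 ^ 4 * ‖⟪h p.2, x (h p.1)⟫_ℂ‖ ^ 2 else 0) :=
      hasSum_sum_of_ne_finset_zero fun p hp => by simp [hp]
    rw [Finset.sum_congr rfl (g := fun p => μ p.1 ^ 4 * ‖⟪h p.2, x (h p.1)⟫_ℂ‖ ^ 2)
      fun p hp => by simp [hp]] at h2
    refine (hasSum_gnsForm_entries hρ hb (X K - x)).unique
      (((hasSum_gnsForm_entries hρ hb x).sub h2).congr_fun fun p => ?_)
    rw [sub_apply, inner_sub_right, hX]
    split_ifs <;> simp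
  -- The GNS distance from `x` to its truncation is the tail of a convergent series.
  have hlim : Tendsto (fun K => gnsForm ρ (X K - x)) atTop (𝓝 0) := by
    simp only [hgns]
    have := (hasSum_gnsForm_entries hρ hb x).const_sub (gnsForm ρ x)
    rwa [sub_self] at this
  -- `T` contracts the GNS form, and a single entry is controlled by that form because its weight is
  -- positive.
  have hTlim : ∀ q : ι × ι,
      Tendsto (fun K => ⟪h q.2, T (X K) (h q.1)⟫_ℂ) atTop (𝓝 ⟪h q.2, T x (h q.1)⟫_ℂ) := by
    intro q
    rw [tendsto_iff_norm_sub_tendsto_zero]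
    have h3 : ∀ K, μ q.1 ^ 4 * ‖⟪h q.2, T (X K) (h q.1)⟫_ℂ - ⟪h q.2, T x (h q.1)⟫_ℂ‖ ^ 2 ≤
        gnsForm ρ (X K - x) := by
      intro K
      rw [← inner_sub_right, ← sub_apply, ← map_sub]
      exact (le_hasSum (hasSum_gnsForm_entries hρ hb (T (X K - x))) q
        fun p _ => by positivity).trans (gnsForm_le_of_isSchwarzMap hρ hT hsub _)
    have h4 := (squeeze_zero (fun K => by positivity) h3 hlim).const_mul ((μ q.1 ^ 4)⁻¹)
    have h5 : (μ q.1 ^ 4) ≠ 0 := (pow_pos (hb.pos _) 4).ne'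
    have h6 := h4.sqrt
    simpa [inv_mul_cancel_left₀ h5] using h6
  refine le_of_sq_le_sq ?_ (norm_nonneg _)
  refine hasSum_le_of_sum_le (hentry (T x)) fun F => ?_
  have hFlim : Tendsto (fun K => ∑ p ∈ F, (μ p.2 * μ p.1) ^ 2 * ‖⟪h p.2, T (X K) (h p.1)⟫_ℂ‖ ^ 2)
      atTop (𝓝 (∑ p ∈ F, (μ p.2 * μ p.1) ^ 2 * ‖⟪h p.2, T x (h p.1)⟫_ℂ‖ ^ 2)) :=
    tendsto_finsetSum _ fun p _ => ((hTlim p).norm.pow 2).const_mul _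
  -- `F` is fixed while `K ⊇ F` grows, so the finite estimate on `K` bounds the sum over `F`.
  refine le_of_tendsto hFlim ((eventually_ge_atTop F).mono fun K hK => ?_)
  calc ∑ p ∈ F, (μ p.2 * μ p.1) ^ 2 * ‖⟪h p.2, T (X K) (h p.1)⟫_ℂ‖ ^ 2
      ≤ ∑ p ∈ K, (μ p.2 * μ p.1) ^ 2 * ‖⟪h p.2, T (X K) (h p.1)⟫_ℂ‖ ^ 2 :=
        Finset.sum_le_sum_of_subset_of_nonneg hK fun p _ _ => by positivity
    _ ≤ ∑ p ∈ K, (μ p.2 * μ p.1) ^ 2 * ‖⟪h p.2, x (h p.1)⟫_ℂ‖ ^ 2 := by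
        rw [← Finset.sum_coe_sort K, ← Finset.sum_coe_sort K]
        exact sum_entries_map_ofEntries_le hρ hb hT hsub K _
    _ ≤ _ := sum_le_hasSum K (fun p _ => by positivity) (hentry x)

end NormalState

/-! ### Convergence of bounded families from a total set -/

section DenseConvergence

variable {τ E G : Type*} [NormedAddCommGroup E] [NormedSpace ℂ E] [NormedAddCommGroup G]
  [NormedSpace ℂ G]

/-- A bounded family of operators that converges on a total set converges everywhere. -/
theorem tendsto_of_tendsto_on_total {l : Filter τ} {F : τ → E →L[ℂ] G} {L : E →L[ℂ] G} {C : ℝ}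
    (hF : ∀ t, ‖F t‖ ≤ C) {D : Set E} (hD : (Submodule.span ℂ D).topologicalClosure = ⊤)
    (h : ∀ x ∈ D, Tendsto (fun t => F t x) l (𝓝 (L x))) (x : E) :
    Tendsto (fun t => F t x) l (𝓝 (L x)) := by
  have hspan : ∀ x ∈ Submodule.span ℂ D, Tendsto (fun t => F t x) l (𝓝 (L x)) := by
    intro x hx
    induction hx using Submodule.span_induction with
    | mem x hx => exact h x hx
    | zero => simpa using tendsto_const_nhds
    | add x y _ _ hx hy => simpa only [map_add] using hx.add hy
    | smul c x _ hx => simpa only [map_smul] using hx.const_smul c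
  have hx : x ∈ closure (Submodule.span ℂ D : Set E) := by
    rw [← Submodule.topologicalClosure_coe, hD]
    trivial
  rw [Metric.tendsto_nhds]
  intro ε hε
  -- The `1` keeps the divisor positive even when `C` and `L` vanish.
  have hM : 0 < |C| + ‖L‖ + 1 := by positivity
  obtain ⟨y, hy, hxy⟩ := Metric.mem_closure_iff.1 hx (ε / (2 * (|C| + ‖L‖ + 1))) (by positivity)
  filter_upwards [Metric.tendsto_nhds.1 (hspan y hy) (ε / 2) (by positivity)] with t ht
  rw [dist_eq_norm] at ht hxy ⊢
  have e : F t x - L x = F t (x - y) + (F t y - L y) - L (x - y) := by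
    simp only [map_sub]; abel
  have h1 : ‖F t (x - y)‖ ≤ |C| * ‖x - y‖ :=
    ContinuousLinearMap.le_of_opNorm_le _ ((hF t).trans (le_abs_self C)) _
  have h2 := L.le_opNorm (x - y)
  have h3 : (|C| + ‖L‖ + 1) * ‖x - y‖ ≤ ε / 2 := by
    rw [lt_div_iff₀ (by positivity)] at hxy
    linarith
  rw [e]
  have h4 := norm_sub_le (F t (x - y) + (F t y - L y)) (L (x - y))
  have h5 := norm_add_le (F t (x - y)) (F t y - L y)
  nlinarith [norm_nonneg (x - y)]

end DenseConvergence

/-! ### From weak to strong limits for contraction semigroups -/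

section ContractionSemigroup

variable {E : Type*} [NormedAddCommGroup E] [InnerProductSpace ℂ E]

/-- Expand the square and use `‖A ξ‖ ≤ ‖ξ‖`; convergence of `⟪ξ, A ξ⟫` to `‖ξ‖²` thus forces norm
convergence. -/
theorem norm_apply_sub_sq_le {A : E →L[ℂ] E} (hA : ‖A‖ ≤ 1) (ξ : E) :
    ‖A ξ - ξ‖ ^ 2 ≤ 2 * (‖ξ‖ ^ 2 - (⟪ξ, A ξ⟫_ℂ).re) := by
  have h1 := norm_sub_sq (𝕜 := ℂ) (A ξ) ξ
  have h2 : ‖A ξ‖ ≤ ‖ξ‖ := by simpa using ContinuousLinearMap.le_of_opNorm_le _ hA ξ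
  have h3 : RCLike.re ⟪A ξ, ξ⟫_ℂ = (⟪ξ, A ξ⟫_ℂ).re := inner_re_symm _ _
  rw [h3] at h1
  have h4 : ‖A ξ‖ ^ 2 ≤ ‖ξ‖ ^ 2 := by gcongr
  linarith

variable {S : ℝ≥0 → E →L[ℂ] E} {ξ ζ : E}

/-- With truncated subtraction, `t - s + (s - t)` is `|t - s|`; factor out the semigroup at the
smaller time. -/
theorem IsOpSemigroup.norm_sub_le (hS : IsOpSemigroup S) (hc : ∀ t, ‖S t‖ ≤ 1) (ξ : E)
    (t s : ℝ≥0) : ‖S t ξ - S s ξ‖ ≤ ‖S (t - s + (s - t)) ξ - ξ‖ := by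
  wlog hst : s ≤ t generalizing s t
  · rw [norm_sub_rev, add_comm]
    exact this s t (le_of_not_ge hst)
  rw [tsub_eq_zero_of_le hst, add_zero]
  have e : S t ξ = S s (S (t - s) ξ) := by
    conv_lhs => rw [← add_tsub_cancel_of_le hst, hS.map_add]
    rfl
  rw [e, ← map_sub]
  simpa using ContinuousLinearMap.le_of_opNorm_le _ (hc s) (S (t - s) ξ - ξ)

theorem IsOpSemigroup.continuous_orbit (hS : IsOpSemigroup S) (hc : ∀ t, ‖S t‖ ≤ 1)
    (h0 : Tendsto (fun t => S t ξ) (𝓝 0) (𝓝 ξ)) : Continuous fun t => S t ξ := by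
  rw [continuous_iff_continuousAt]
  intro s
  rw [ContinuousAt, tendsto_iff_norm_sub_tendsto_zero]
  have h1 : Tendsto (fun t : ℝ≥0 => t - s + (s - t)) (𝓝 s) (𝓝 0) := by
    have : Continuous fun t : ℝ≥0 => t - s + (s - t) := by fun_prop
    simpa using this.tendsto s
  exact squeeze_zero (fun t => norm_nonneg _) (fun t => hS.norm_sub_le hc ξ t s)
    (tendsto_iff_norm_sub_tendsto_zero.1 (h0.comp h1))

theorem diffQuot_zero_add (S : ℝ≥0 → E →L[ℂ] E) (ξ : E) {t : ℝ≥0} (ht : 0 < t) :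
    S t ξ = ξ + ((t : ℝ) : ℂ) • diffQuot S ξ t := by
  have : ((t : ℝ) : ℂ) ≠ 0 := by exact_mod_cast ht.ne'
  rw [diffQuot, smul_smul, mul_inv_cancel₀ this, one_smul, add_sub_cancel]

theorem IsOpSemigroup.tendsto_zero_of_weak_deriv (hS : IsOpSemigroup S) (hc : ∀ t, ‖S t‖ ≤ 1)
    (hw : Tendsto (fun t => ⟪ξ, diffQuot S ξ t⟫_ℂ) (𝓝[>] 0) (𝓝 ⟪ξ, ζ⟫_ℂ)) :
    Tendsto (fun t => S t ξ) (𝓝 0) (𝓝 ξ) := by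
  have h1 : Tendsto (fun t : ℝ≥0 => ((t : ℝ) : ℂ) * ⟪ξ, diffQuot S ξ t⟫_ℂ) (𝓝[>] 0) (𝓝 0) := by
    have h2 : Tendsto (fun t : ℝ≥0 => ((t : ℝ) : ℂ)) (𝓝[>] 0) (𝓝 0) := by
      have : Continuous fun t : ℝ≥0 => ((t : ℝ) : ℂ) := by fun_prop
      simpa using (this.tendsto 0).mono_left nhdsWithin_le_nhds
    simpa using h2.mul hw
  have h3 : Tendsto (fun t => ‖S t ξ - ξ‖) (𝓝[>] 0) (𝓝 0) := by
    have h4 : ∀ᶠ t : ℝ≥0 in 𝓝[>] 0,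
        ‖S t ξ - ξ‖ ^ 2 ≤ -2 * (((t : ℝ) : ℂ) * ⟪ξ, diffQuot S ξ t⟫_ℂ).re := by
      filter_upwards [self_mem_nhdsWithin] with t ht
      refine (norm_apply_sub_sq_le (hc t) ξ).trans_eq ?_
      conv_lhs => rw [diffQuot_zero_add S ξ ht, inner_add_right, inner_smul_right, Complex.add_re,
        inner_self_eq_norm_sq_to_K]
      have : (((‖ξ‖ : ℂ)) ^ 2).re = ‖ξ‖ ^ 2 := by norm_cast
      erw [this]
      ring
    have h5 := ((Complex.continuous_re.tendsto _).comp h1).const_mul (-2)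
    have h6 := (squeeze_zero' (Eventually.of_forall fun t => by positivity) h4
      (by simpa using h5)).sqrt
    simpa using h6
  rw [tendsto_iff_norm_sub_tendsto_zero]
  -- Zero is the least element, so only the point itself must be added to the right-hand limit.
  have h7 : 𝓝 (0 : ℝ≥0) = pure 0 ⊔ 𝓝[>] 0 := by
    have : (Set.Ici (0 : ℝ≥0)) = Set.univ := by ext; simp
    rw [← nhdsWithin_univ, ← this, ← Set.Ioi_insert, nhdsWithin_insert]
  rw [h7]
  refine Tendsto.sup ?_ h3
  rw [tendsto_pure_left]
  intro s hs
  have : ‖S 0 ξ - ξ‖ = 0 := by simp [hS.map_zero]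
  rw [this]
  exact mem_of_mem_nhds hs

/-- For fixed `η`, the function `Re ⟪η, S_s ξ⟫` is continuous with right derivative `Re ⟪η, S_s ζ⟫`,
at most `‖η‖ ‖ζ‖`; the mean value inequality applies. -/
theorem IsOpSemigroup.norm_sub_le_of_weak_deriv [CompleteSpace E] (hS : IsOpSemigroup S)
    (hc : ∀ t, ‖S t‖ ≤ 1)
    (hw : ∀ η, Tendsto (fun t => ⟪η, diffQuot S ξ t⟫_ℂ) (𝓝[>] 0) (𝓝 ⟪η, ζ⟫_ℂ)) (t : ℝ≥0) :
    ‖S t ξ - ξ‖ ≤ t * ‖ζ‖ := by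
  have hcont := hS.continuous_orbit hc (hS.tendsto_zero_of_weak_deriv hc (hw ξ))
  have key : ∀ η, (⟪η, S t ξ⟫_ℂ).re ≤ (⟪η, ξ⟫_ℂ).re + ‖η‖ * ‖ζ‖ * t := by
    intro η
    let g : ℝ → ℝ := fun s => (⟪η, S s.toNNReal ξ⟫_ℂ).re
    have hg : Continuous g := Complex.continuous_re.comp
      (continuous_const.inner (hcont.comp continuous_real_toNNReal))
    have hd : ∀ s ∈ Set.Ico (0 : ℝ) t,
        HasDerivWithinAt g (⟪η, S s.toNNReal ζ⟫_ℂ).re (Set.Ici s) s := by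
      intro s hs
      rw [← hasDerivWithinAt_Ioi_iff_Ici, hasDerivWithinAt_iff_tendsto_slope' (by simp)]
      have h1 : Tendsto (fun r : ℝ => (r - s).toNNReal) (𝓝[>] s) (𝓝[>] 0) := by
        rw [tendsto_nhdsWithin_iff]
        constructor
        · have : Continuous fun r : ℝ => (r - s).toNNReal := by fun_prop
          simpa using (this.tendsto s).mono_left nhdsWithin_le_nhds
        · filter_upwards [self_mem_nhdsWithin] with r hr
          simpa using hr
      have h2 := (Complex.continuous_re.tendsto _).comp
        ((hw (ContinuousLinearMap.adjoint (S s.toNNReal) η)).comp h1)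
      rw [ContinuousLinearMap.adjoint_inner_left] at h2
      refine h2.congr' ?_
      filter_upwards [self_mem_nhdsWithin] with r hr
      have hr' : 0 < r - s := sub_pos.2 hr
      have e : r.toNNReal = s.toNNReal + (r - s).toNNReal := by
        rw [← Real.toNNReal_add hs.1 hr'.le]; congr 1; ring
      simp only [Function.comp, ContinuousLinearMap.adjoint_inner_left, g, slope_def_field]
      rw [e, hS.map_add, diffQuot, map_smul, map_sub, inner_smul_right, inner_sub_right,
        Real.coe_toNNReal _ hr'.le, ← Complex.ofReal_inv, Complex.re_ofReal_mul, Complex.sub_re,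
        div_eq_inv_mul]
      rfl
    have h3 := image_le_of_deriv_right_le_deriv_boundary
      (B := fun s => (⟪η, ξ⟫_ℂ).re + ‖η‖ * ‖ζ‖ * s)
      (B' := fun _ => ‖η‖ * ‖ζ‖) hg.continuousOn hd (by simp [g, hS.map_zero])
      (by fun_prop) (fun s _ => by
        have h4 : HasDerivAt (fun s => (⟪η, ξ⟫_ℂ).re + ‖η‖ * ‖ζ‖ * s) (‖η‖ * ‖ζ‖ * 1) s :=
          ((hasDerivAt_id s).const_mul _).const_add _
        rw [mul_one] at h4
        exact h4.hasDerivWithinAt)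
      (fun s _ => by
        refine (Complex.re_le_norm _).trans ((norm_inner_le_norm _ _).trans ?_)
        gcongr
        simpa using ContinuousLinearMap.le_of_opNorm_le _ (hc s.toNNReal) ζ)
      (Set.right_mem_Icc.2 t.2)
    simpa [g] using h3
  -- This choice of `η` turns the weak estimate into one for the norm.
  have h1 := key (S t ξ - ξ)
  have h2 : (⟪S t ξ - ξ, S t ξ⟫_ℂ).re - (⟪S t ξ - ξ, ξ⟫_ℂ).re = ‖S t ξ - ξ‖ ^ 2 := by
    rw [← Complex.sub_re, ← inner_sub_right, inner_self_eq_norm_sq_to_K]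
    norm_cast
  by_contra! hlt
  have h3 : 0 < ‖S t ξ - ξ‖ := lt_of_le_of_lt (by positivity) hlt
  nlinarith

/-- For contraction semigroups on a Hilbert space a weak derivative at `0` is a strong one. -/
theorem IsOpSemigroup.tendsto_diffQuot_of_weak [CompleteSpace E] (hS : IsOpSemigroup S)
    (hc : ∀ t, ‖S t‖ ≤ 1)
    (hw : ∀ η, Tendsto (fun t => ⟪η, diffQuot S ξ t⟫_ℂ) (𝓝[>] 0) (𝓝 ⟪η, ζ⟫_ℂ)) :
    Tendsto (diffQuot S ξ) (𝓝[>] 0) (𝓝 ζ) := by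
  rw [tendsto_iff_norm_sub_tendsto_zero]
  have h1 : ∀ᶠ t : ℝ≥0 in 𝓝[>] 0,
      ‖diffQuot S ξ t - ζ‖ ^ 2 ≤ 2 * (‖ζ‖ ^ 2 - (⟪ζ, diffQuot S ξ t⟫_ℂ).re) := by
    filter_upwards [self_mem_nhdsWithin] with t ht
    have ht' : (0 : ℝ) < t := ht
    -- Norms not exceeding that of the weak limit upgrade weak convergence to norm convergence.
    have h2 : ‖diffQuot S ξ t‖ ≤ ‖ζ‖ := by
      rw [diffQuot, norm_smul, norm_inv, Complex.norm_real, Real.norm_eq_abs, abs_of_pos ht',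
        inv_mul_le_iff₀ ht']
      exact hS.norm_sub_le_of_weak_deriv hc hw t
    have h3 := norm_sub_sq (𝕜 := ℂ) (diffQuot S ξ t) ζ
    have h4 : RCLike.re ⟪diffQuot S ξ t, ζ⟫_ℂ = (⟪ζ, diffQuot S ξ t⟫_ℂ).re := inner_re_symm _ _
    rw [h4] at h3
    have h5 : ‖diffQuot S ξ t‖ ^ 2 ≤ ‖ζ‖ ^ 2 := by gcongr
    linarith
  have h2 := (((Complex.continuous_re.tendsto _).comp (hw ζ)).const_sub (‖ζ‖ ^ 2)).const_mul 2
  have h3 : ‖ζ‖ ^ 2 - (⟪ζ, ζ⟫_ℂ).re = 0 := by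
    rw [inner_self_eq_norm_sq_to_K, sub_eq_zero]
    norm_cast
  rw [h3, mul_zero] at h2
  have h4 := (squeeze_zero' (Eventually.of_forall fun t => by positivity) h1 h2).sqrt
  simpa using h4

end ContractionSemigroup

/-! ### The induced semigroup and its generator -/

section Induced

variable {H : Type*} [NormedAddCommGroup H] [InnerProductSpace ℂ H] [CompleteSpace H] {ι : Type*}
  {ρ : H →L[ℂ] H} {h : HilbertBasis ι ℂ H} {μ : ι → ℝ}

open InnerProductSpace

/-- The map `i_ρ` with values in `S₂(H)`. -/
noncomputable def iRhoS2 (hρ : IsFaithfulNormalState ρ) : (H →L[ℂ] H) →ₗ[ℂ] S2 H where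
  toFun x := S2.mk (iRho ρ x) (hρ.isHilbertSchmidt_iRho x)
  map_add' x y := S2.ext <| by
    simp only [map_add, S2.toOp_mk, iRho, mul_add, add_mul]
  map_smul' c x := S2.ext <| by
    simp only [map_smul, S2.toOp_mk, iRho, mul_smul_comm, smul_mul_assoc, RingHom.id_apply]

theorem toOp_iRhoS2 (hρ : IsFaithfulNormalState ρ) (x : H →L[ℂ] H) :
    S2.toOp (iRhoS2 hρ x) = iRho ρ x := rfl

/-- `i_ρ` only rescales the rank-one operator by `μ n * μ m`, so the pairing extracts one matrix
entry. -/
theorem inner_iRhoS2_rankOne (hρ : IsFaithfulNormalState ρ) (hb : IsQuarterEigenbasis ρ h μ)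
    (n m : ι) (a : S2 H) :
    ⟪iRhoS2 hρ (rankOne ℂ (h n) (h m)), a⟫_ℂ =
      ((μ n * μ m : ℝ) : ℂ) * ⟪h n, S2.toOp a (h m)⟫_ℂ := by
  classical
  refine (S2.hasSum_inner h _ a).unique ?_
  have hort := orthonormal_iff_ite.1 h.orthonormal
  have key : ∀ k, iRho ρ (rankOne ℂ (h n) (h m)) (h k) =
      if m = k then ((μ n * μ m : ℝ) : ℂ) • h n else 0 := by
    intro k
    rw [iRho, mul_apply_eq_comp, mul_apply_eq_comp, hb.apply, map_smul, rankOne_apply, hort]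
    split_ifs with hmk
    · rw [one_smul, map_smul, hb.apply, smul_smul, hmk]
      push_cast
      ring_nf
    · simp
  have h1 : ∀ k, k ≠ m →
      ⟪S2.toOp (iRhoS2 hρ (rankOne ℂ (h n) (h m))) (h k), S2.toOp a (h k)⟫_ℂ = 0 := fun k hk => by
    rw [toOp_iRhoS2, key, if_neg hk.symm, inner_zero_left]
  convert! hasSum_single m h1 using 1
  rw [toOp_iRhoS2, key, if_pos rfl, inner_smul_left, Complex.conj_ofReal]

theorem inner_iRhoS2_rankOne_iRhoS2 (hρ : IsFaithfulNormalState ρ)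
    (hb : IsQuarterEigenbasis ρ h μ) (n m : ι) (x : H →L[ℂ] H) :
    ⟪iRhoS2 hρ (rankOne ℂ (h n) (h m)), iRhoS2 hρ x⟫_ℂ =
      (((μ n * μ m) ^ 2 : ℝ) : ℂ) * ⟪h n, x (h m)⟫_ℂ := by
  rw [inner_iRhoS2_rankOne hρ hb, toOp_iRhoS2, iRho_entry hb, ← mul_assoc, ← Complex.ofReal_mul,
    sq]

theorem topologicalClosure_span_iRhoS2_rankOne (hρ : IsFaithfulNormalState ρ)
    (hb : IsQuarterEigenbasis ρ h μ) :
    (Submodule.span ℂ (Set.range fun p : ι × ι =>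
      iRhoS2 hρ (rankOne ℂ (h p.1) (h p.2)))).topologicalClosure = ⊤ := by
  rw [Submodule.topologicalClosure_eq_top_iff, eq_bot_iff]
  intro a ha
  have h1 : ∀ p : ι × ι, ‖⟪h p.2, S2.toOp a (h p.1)⟫_ℂ‖ ^ 2 = 0 := fun p => by
    have h2 := (Submodule.mem_orthogonal _ _).1 ha _ (Submodule.subset_span ⟨(p.2, p.1), rfl⟩)
    rw [inner_iRhoS2_rankOne hρ hb, mul_eq_zero] at h2
    have h3 : ((μ p.2 * μ p.1 : ℝ) : ℂ) ≠ 0 := by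
      exact_mod_cast (mul_pos (hb.pos _) (hb.pos _)).ne'
    rw [h2.resolve_left h3]
    simp
  have h4 := S2.hasSum_entries h a
  simp only [h1] at h4
  simpa using h4.unique hasSum_zero

theorem denseRange_iRhoS2 (hρ : IsFaithfulNormalState ρ) : DenseRange (iRhoS2 hρ) := by
  obtain ⟨ι, h, μ, hb⟩ := hρ.exists_eigenbasis
  have h1 := topologicalClosure_span_iRhoS2_rankOne hρ hb
  rw [← Submodule.dense_iff_topologicalClosure_eq_top] at h1
  refine h1.mono ?_
  rw [← LinearMap.coe_range, SetLike.coe_subset_coe, Submodule.span_le]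
  rintro _ ⟨p, rfl⟩
  exact ⟨_, rfl⟩

/-- The norm is dominated by the two GNS forms, each at most `‖x‖² ω_ρ(1)`. -/
theorem exists_norm_iRhoS2_le (hρ : IsFaithfulNormalState ρ) :
    ∃ C, ∀ x, ‖iRhoS2 hρ x‖ ≤ C * ‖x‖ := by
  obtain ⟨ι, h, μ, hb⟩ := hρ.exists_eigenbasis
  have hgns : ∀ x, gnsForm ρ x ≤ ‖x‖ ^ 2 * gnsForm ρ 1 := by
    intro x
    refine hasSum_le (fun n => ?_) (hasSum_gnsForm hρ hb x)
      ((hasSum_gnsForm hρ hb 1).mul_left (‖x‖ ^ 2))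
    have h1 : ‖x (h n)‖ ^ 2 ≤ ‖x‖ ^ 2 * ‖h n‖ ^ 2 := by
      rw [← mul_pow]
      gcongr
      exact x.le_opNorm _
    have h2 : 0 ≤ μ n ^ 4 := by positivity
    rw [one_apply_eq_self]
    nlinarith
  have h0 : 0 ≤ gnsForm ρ 1 := (hasSum_gnsForm hρ hb 1).nonneg fun n => by positivity
  refine ⟨√(2 * gnsForm ρ 1), fun x => le_of_sq_le_sq ?_ (by positivity)⟩
  have h1 : ‖iRhoS2 hρ x‖ ^ 2 ≤ gnsForm ρ x + gnsForm ρ (star x) := by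
    refine hasSum_le (fun p => ?_) (S2.hasSum_entries h (iRhoS2 hρ x))
      ((hasSum_gnsForm_entries hρ hb x).add (hasSum_gnsForm_star_entries hρ hb x))
    rw [toOp_iRhoS2, norm_iRho_entry_sq hb, ← add_mul]
    gcongr
    nlinarith [sq_nonneg (μ p.1 ^ 2 - μ p.2 ^ 2), sq_nonneg (μ p.1 ^ 2), sq_nonneg (μ p.2 ^ 2)]
  have h2 := hgns x
  have h3 := hgns (star x)
  rw [norm_star] at h3
  rw [mul_pow, Real.sq_sqrt (by positivity)]
  linarith

/-- The operator on `S₂(H)` induced by an operator on `B(H)`. -/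
noncomputable def inducedCLM (hρ : IsFaithfulNormalState ρ) (T : (H →L[ℂ] H) →L[ℂ] (H →L[ℂ] H)) :
    S2 H →L[ℂ] S2 H :=
  (iRhoS2 hρ ∘ₗ (T : (H →L[ℂ] H) →ₗ[ℂ] (H →L[ℂ] H))).extendOfNorm (iRhoS2 hρ)

theorem norm_iRhoS2_map_le (hρ : IsFaithfulNormalState ρ)
    {T : (H →L[ℂ] H) →L[ℂ] (H →L[ℂ] H)} (hT : IsSchwarzMap T) (hsub : IsSubinvariant ρ T)
    (x : H →L[ℂ] H) :
    ‖(iRhoS2 hρ ∘ₗ (T : (H →L[ℂ] H) →ₗ[ℂ] (H →L[ℂ] H))) x‖ ≤ 1 * ‖iRhoS2 hρ x‖ := by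
  rw [one_mul]
  exact norm_iRho_map_le hρ hT hsub x

theorem inducedCLM_apply (hρ : IsFaithfulNormalState ρ)
    {T : (H →L[ℂ] H) →L[ℂ] (H →L[ℂ] H)} (hT : IsSchwarzMap T) (hsub : IsSubinvariant ρ T)
    (x : H →L[ℂ] H) : inducedCLM hρ T (iRhoS2 hρ x) = iRhoS2 hρ (T x) :=
  LinearMap.extendOfNorm_eq (denseRange_iRhoS2 hρ) ⟨1, norm_iRhoS2_map_le hρ hT hsub⟩ x

theorem norm_inducedCLM_le (hρ : IsFaithfulNormalState ρ)
    {T : (H →L[ℂ] H) →L[ℂ] (H →L[ℂ] H)} (hT : IsSchwarzMap T) (hsub : IsSubinvariant ρ T) :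
    ‖inducedCLM hρ T‖ ≤ 1 :=
  LinearMap.opNorm_extendOfNorm_le (denseRange_iRhoS2 hρ) zero_le_one
    (norm_iRhoS2_map_le hρ hT hsub)

theorem eq_of_eq_on_iRhoS2 (hρ : IsFaithfulNormalState ρ) {A B : S2 H →L[ℂ] S2 H}
    (hAB : ∀ x, A (iRhoS2 hρ x) = B (iRhoS2 hρ x)) : A = B :=
  DFunLike.coe_injective <|
    (denseRange_iRhoS2 hρ).equalizer A.continuous B.continuous (funext hAB)

variable {T : ℝ≥0 → (H →L[ℂ] H) →L[ℂ] (H →L[ℂ] H)} {Tt : ℝ≥0 → S2 H →L[ℂ] S2 H}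

theorem isInducedSemigroup_inducedCLM (hρ : IsFaithfulNormalState ρ) (hT : IsOpSemigroup T)
    (hSchwarz : ∀ t, IsSchwarzMap (T t)) (hsub : ∀ t, IsSubinvariant ρ (T t)) :
    IsInducedSemigroup ρ hρ.isHilbertSchmidt_iRho T fun t => inducedCLM hρ (T t) where
  semigroup :=
    { map_zero := eq_of_eq_on_iRhoS2 hρ fun x => by
        rw [inducedCLM_apply hρ (hSchwarz 0) (hsub 0), hT.map_zero]
        rfl
      map_add := fun t s => eq_of_eq_on_iRhoS2 hρ fun x => by
        rw [inducedCLM_apply hρ (hSchwarz _) (hsub _), ContinuousLinearMap.comp_apply,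
          inducedCLM_apply hρ (hSchwarz _) (hsub _), inducedCLM_apply hρ (hSchwarz _) (hsub _),
          hT.map_add]
        rfl }
  contraction := fun t => norm_inducedCLM_le hρ (hSchwarz t) (hsub t)
  intertwine := fun t => inducedCLM_apply hρ (hSchwarz t) (hsub t)

theorem diffQuot_iRhoS2 (hρ : IsFaithfulNormalState ρ)
    (hi : IsInducedSemigroup ρ hρ.isHilbertSchmidt_iRho T Tt) (x : H →L[ℂ] H) (t : ℝ≥0) :
    diffQuot Tt (iRhoS2 hρ x) t = iRhoS2 hρ (diffQuot T x t) := by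
  have h1 : Tt t (iRhoS2 hρ x) = iRhoS2 hρ (T t x) := hi.intertwine t x
  rw [diffQuot, diffQuot, h1, map_smul, map_sub]

/-- Contractivity reduces continuity to time zero and to rank-one operators, where weak* continuity
gives convergence of the diagonal coefficient. -/
theorem IsInducedSemigroup.isStronglyContinuous (hρ : IsFaithfulNormalState ρ)
    (hi : IsInducedSemigroup ρ hρ.isHilbertSchmidt_iRho T Tt)
    (hw : IsWeakStarContinuous T) : IsStronglyContinuous Tt := by
  obtain ⟨ι, h, μ, hb⟩ := hρ.exists_eigenbasis
  intro ξ
  refine hi.semigroup.continuous_orbit hi.contraction ?_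
  refine tendsto_of_tendsto_on_total (L := ContinuousLinearMap.id ℂ (S2 H)) hi.contraction
    (topologicalClosure_span_iRhoS2_rankOne hρ hb) ?_ ξ
  rintro _ ⟨⟨n, m⟩, rfl⟩
  set x := rankOne ℂ (h n) (h m) with hx
  have h1 : Tendsto (fun t => ⟪iRhoS2 hρ x, Tt t (iRhoS2 hρ x)⟫_ℂ) (𝓝 0)
      (𝓝 ⟪iRhoS2 hρ x, iRhoS2 hρ x⟫_ℂ) := by
    have h2 : ∀ t, ⟪iRhoS2 hρ x, Tt t (iRhoS2 hρ x)⟫_ℂ =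
        (((μ n * μ m) ^ 2 : ℝ) : ℂ) * opTrace (rankOne ℂ (h m) (h n) * T t x) := fun t => by
      rw [opTrace_rankOne_mul, ← inner_iRhoS2_rankOne_iRhoS2 hρ hb]
      exact congrArg _ (hi.intertwine t x)
    have h3 : Continuous fun t => ⟪iRhoS2 hρ x, Tt t (iRhoS2 hρ x)⟫_ℂ := by
      simp only [h2]
      exact continuous_const.mul (hw _ (rankOne_isTraceClass _ _) x)
    simpa [hi.semigroup.map_zero] using h3.tendsto 0
  rw [tendsto_iff_norm_sub_tendsto_zero]
  have h2 := (((Complex.continuous_re.tendsto _).comp h1).const_sub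
    (‖iRhoS2 hρ x‖ ^ 2)).const_mul 2
  have h3 : ‖iRhoS2 hρ x‖ ^ 2 - (⟪iRhoS2 hρ x, iRhoS2 hρ x⟫_ℂ).re = 0 := by
    rw [inner_self_eq_norm_sq_to_K, sub_eq_zero]
    norm_cast
  rw [h3, mul_zero] at h2
  have h4 := (squeeze_zero (fun t => by positivity)
    (fun t => norm_apply_sub_sq_le (hi.contraction t) (iRhoS2 hρ x)) h2).sqrt
  simpa using h4

/-- Uniform boundedness twice, first in `u` and then in `v`. A sequence is used because its
convergence bounds every term. -/
theorem exists_norm_le_of_tendsto_inner {D : ℕ → H →L[ℂ] H} {z : H →L[ℂ] H}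
    (hD : ∀ u v, Tendsto (fun k => ⟪u, D k v⟫_ℂ) atTop (𝓝 ⟪u, z v⟫_ℂ)) :
    ∃ C, ∀ k, ‖D k‖ ≤ C := by
  refine banach_steinhaus fun v => ?_
  have h1 : ∃ C, ∀ k, ‖innerSL ℂ (D k v)‖ ≤ C := by
    refine banach_steinhaus fun u => ?_
    obtain ⟨C, hC⟩ := ((hD u v).norm).bddAbove_range
    refine ⟨C, fun k => ?_⟩
    rw [innerSL_apply_apply, norm_inner_symm]
    exact hC ⟨k, rfl⟩
  simpa only [innerSL_apply_norm] using h1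

theorem tendsto_inner_iRhoS2 (hρ : IsFaithfulNormalState ρ) {D : ℕ → H →L[ℂ] H} {z : H →L[ℂ] H}
    (hD : ∀ u v, Tendsto (fun k => ⟪u, D k v⟫_ℂ) atTop (𝓝 ⟪u, z v⟫_ℂ)) (η : S2 H) :
    Tendsto (fun k => ⟪η, iRhoS2 hρ (D k)⟫_ℂ) atTop (𝓝 ⟪η, iRhoS2 hρ z⟫_ℂ) := by
  obtain ⟨ι, h, μ, hb⟩ := hρ.exists_eigenbasis
  obtain ⟨C, hC⟩ := exists_norm_le_of_tendsto_inner hD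
  obtain ⟨M, hM⟩ := exists_norm_iRhoS2_le hρ
  -- The varying vector sits in the antilinear slot so that the functional is linear in `η`;
  -- conjugation restores the order.
  have h1 : ∀ k, ‖innerSL ℂ (iRhoS2 hρ (D k))‖ ≤ |M| * C := fun k => by
    rw [innerSL_apply_norm]
    refine (hM _).trans (mul_le_mul (le_abs_self M) (hC k) (norm_nonneg _) (abs_nonneg M))
  have h2 := tendsto_of_tendsto_on_total (l := atTop) (L := innerSL ℂ (iRhoS2 hρ z)) h1
    (topologicalClosure_span_iRhoS2_rankOne hρ hb) (by
      rintro _ ⟨⟨n, m⟩, rfl⟩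
      have h3 := (Complex.continuous_conj.tendsto _).comp
        ((hD (h n) (h m)).const_mul ((((μ n * μ m) ^ 2 : ℝ) : ℂ)))
      simp only [Function.comp_def, ← inner_iRhoS2_rankOne_iRhoS2 hρ hb, inner_conj_symm] at h3
      exact h3) η
  have h4 := (Complex.continuous_conj.tendsto _).comp h2
  simpa only [Function.comp_def, innerSL_apply_apply, inner_conj_symm] using h4

theorem IsInducedSemigroup.tendsto_diffQuot (hρ : IsFaithfulNormalState ρ)
    (hi : IsInducedSemigroup ρ hρ.isHilbertSchmidt_iRho T Tt) {x z : H →L[ℂ] H}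
    (hx : IsWeakStarDeriv T x z) :
    Tendsto (diffQuot Tt (iRhoS2 hρ x)) (𝓝[>] 0) (𝓝 (iRhoS2 hρ z)) := by
  refine hi.semigroup.tendsto_diffQuot_of_weak hi.contraction fun η => ?_
  simp only [diffQuot_iRhoS2 hρ hi]
  -- Sequences make the uniform boundedness argument available.
  refine Filter.tendsto_of_seq_tendsto fun u hu => ?_
  refine tendsto_inner_iRhoS2 hρ (D := fun k => diffQuot T x (u k)) (fun v w => ?_) η
  have h1 := (hx (rankOne ℂ w v) (rankOne_isTraceClass w v)).comp hu
  simpa only [Function.comp_def, opTrace_rankOne_mul] using h1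

/-- Pairing the norm limit with `i_ρ` of a rank-one operator yields the factor `(μ n * μ m)²` on the
quotient and `μ n * μ m` on the limit; dividing leaves one inverse factor. -/
theorem tendsto_inner_diffQuot (hρ : IsFaithfulNormalState ρ) (hb : IsQuarterEigenbasis ρ h μ)
    (hi : IsInducedSemigroup ρ hρ.isHilbertSchmidt_iRho T Tt) {x : H →L[ℂ] H}
    (hx : iRhoS2 hρ x ∈ genDomain Tt) (n m : ι) :
    Tendsto (fun t => ⟪h n, diffQuot T x t (h m)⟫_ℂ) (𝓝[>] 0)
      (𝓝 (((μ n * μ m : ℝ) : ℂ)⁻¹ * ⟪h n, S2.toOp (gen Tt (iRhoS2 hρ x)) (h m)⟫_ℂ)) := by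
  have h1 : Tendsto (diffQuot Tt (iRhoS2 hρ x)) (𝓝[>] 0) (𝓝 (gen Tt (iRhoS2 hρ x))) :=
    tendsto_nhds_limUnder hx
  have hne : ((μ n * μ m : ℝ) : ℂ) ≠ 0 := by
    exact_mod_cast (mul_pos (hb.pos _) (hb.pos _)).ne'
  have h2 := ((tendsto_const_nhds (x := iRhoS2 hρ (rankOne ℂ (h n) (h m)))).inner (𝕜 := ℂ)
    h1).const_mul ((((μ n * μ m) ^ 2 : ℝ) : ℂ)⁻¹)
  simp only [diffQuot_iRhoS2 hρ hi, inner_iRhoS2_rankOne_iRhoS2 hρ hb,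
    inner_iRhoS2_rankOne hρ hb] at h2
  rw [Complex.ofReal_pow] at h2
  convert h2 using 2
  · rw [inv_mul_cancel_left₀ (pow_ne_zero 2 hne)]
  · field_simp

end Induced

/-! ### The Moore–Penrose inverse of the injective quarter power -/

section PseudoInverse

variable {H : Type*} [NormedAddCommGroup H] [InnerProductSpace ℂ H] [CompleteSpace H]
  {ρ : H →L[ℂ] H}

theorem IsFaithfulNormalState.rpow_quarter_injective (hρ : IsFaithfulNormalState ρ) {v : H}
    (hv : (ρ ^ (1 / 4 : ℝ)) v = 0) : v = 0 := by
  refine hρ.eq_zero_of_apply_eq_zero ?_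
  rw [← rpow_quarter_pow_four hρ.nonneg]
  simp only [mul_apply_eq_comp, hv, map_zero]

/-- `ρ^{1/4}` is self-adjoint and injective, so the orthogonal complement of its range is zero and
the defect in `pinvGraph` vanishes. -/
theorem rpow_quarter_pinv_apply (hρ : IsFaithfulNormalState ρ)
    (v : (pinv (ρ ^ (1 / 4 : ℝ))).domain) :
    (ρ ^ (1 / 4 : ℝ)) (pinv (ρ ^ (1 / 4 : ℝ)) v) = v := by
  have h1 := Submodule.mem_graph_toLinearPMap (pinvGraph_snd_eq_zero (ρ ^ (1 / 4 : ℝ))) v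
  have h2 : (v : H) - (ρ ^ (1 / 4 : ℝ)) (pinv (ρ ^ (1 / 4 : ℝ)) v) ∈
      (LinearMap.range ((ρ ^ (1 / 4 : ℝ) : H →L[ℂ] H) : H →ₗ[ℂ] H))ᗮ := h1.2
  set w := (v : H) - (ρ ^ (1 / 4 : ℝ)) (pinv (ρ ^ (1 / 4 : ℝ)) v) with hw
  have h3 : (ρ ^ (1 / 4 : ℝ)) w = 0 := by
    rw [← inner_self_eq_zero (𝕜 := ℂ), inner_rpow_quarter]
    exact (Submodule.mem_orthogonal' _ _).1 h2 _ ⟨_, rfl⟩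
  have h4 := hρ.rpow_quarter_injective h3
  exact (sub_eq_zero.1 h4).symm

theorem rpow_quarter_apply_mem_pinv_domain (hρ : IsFaithfulNormalState ρ) (u : H) :
    (ρ ^ (1 / 4 : ℝ)) u ∈ (pinv (ρ ^ (1 / 4 : ℝ))).domain := by
  refine ⟨((ρ ^ (1 / 4 : ℝ)) u, u), ⟨?_, by simp⟩, rfl⟩
  refine (Submodule.mem_orthogonal _ _).2 fun w hw => ?_
  rw [hρ.rpow_quarter_injective (v := w) hw, inner_zero_left]

theorem pinv_eq_of_apply_eq (hρ : IsFaithfulNormalState ρ) {u : H}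
    (v : (pinv (ρ ^ (1 / 4 : ℝ))).domain) (hu : (ρ ^ (1 / 4 : ℝ)) u = v) :
    pinv (ρ ^ (1 / 4 : ℝ)) v = u := by
  rw [← sub_eq_zero]
  refine hρ.rpow_quarter_injective ?_
  rw [map_sub, rpow_quarter_pinv_apply hρ, hu, sub_self]

/-- The witness is `w = r v`; the two equations eliminate the partially defined maps from later
computations. -/
theorem exists_apply_eq_iRhoInv (hρ : IsFaithfulNormalState ρ) (y : H →L[ℂ] H)
    (v : (iRhoInv ρ y).domain) :
    ∃ w, (ρ ^ (1 / 4 : ℝ)) w = v ∧ (ρ ^ (1 / 4 : ℝ)) (iRhoInv ρ y v) = y w := by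
  have hv : (v : H) ∈ (pinv (ρ ^ (1 / 4 : ℝ))).domain := by
    obtain ⟨v, h1, h2⟩ := v
    exact h2
  refine ⟨pinv (ρ ^ (1 / 4 : ℝ)) ⟨v, hv⟩, rpow_quarter_pinv_apply hρ _, ?_⟩
  exact rpow_quarter_pinv_apply hρ _

end PseudoInverse

/-! ### Assembly of the theorem -/

theorem mainTheorem1 {H : Type*} [NormedAddCommGroup H] [InnerProductSpace ℂ H] [CompleteSpace H]
    (T : ℝ≥0 → (H →L[ℂ] H) →L[ℂ] (H →L[ℂ] H)) (hT : IsOpSemigroup T)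
    (hSchwarz : ∀ t, IsSchwarzMap (T t))
    (ρ : H →L[ℂ] H) (hρ : IsFaithfulNormalState ρ) (hsub : ∀ t, IsSubinvariant ρ (T t)) :
    ∃ hi : ∀ x : H →L[ℂ] H, IsHilbertSchmidt (iRho ρ x),
    ∃ Tt : ℝ≥0 → S2 H →L[ℂ] S2 H,
      IsInducedSemigroup ρ hi T Tt ∧
      (∀ S : ℝ≥0 → S2 H →L[ℂ] S2 H, IsInducedSemigroup ρ hi T S → S = Tt) ∧
      (IsWeakStarContinuous T → IsStronglyContinuous Tt) ∧
      (∀ x ∈ weakStarGenDomain T,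
        S2.mk (iRho ρ x) (hi x) ∈ genDomain Tt ∧
        gen Tt (S2.mk (iRho ρ x) (hi x)) =
          S2.mk (iRho ρ (weakStarGen T x)) (hi (weakStarGen T x))) ∧
      (∀ {ι : Type*} (h : HilbertBasis ι ℂ H), (∀ n, ∃ c : ℂ, ρ (h n) = c • h n) →
        ∀ x : H →L[ℂ] H, S2.mk (iRho ρ x) (hi x) ∈ genDomain Tt →
          x ∈ extGenDomain T h ∧
          -- equality of matrix entries
          (∃ hd : ∀ n, h n ∈ (pinv (ρ ^ (1 / 4 : ℝ))).domain,
            ∀ n m, extGen T h x n m =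
              ⟪pinv (ρ ^ (1 / 4 : ℝ)) ⟨h n, hd n⟩,
                S2.toOp (gen Tt (S2.mk (iRho ρ x) (hi x)))
                  (pinv (ρ ^ (1 / 4 : ℝ)) ⟨h m, hd m⟩)⟫_ℂ) ∧
          -- equality as linear maps wherever `i_{ρ^{(-1)}}(L̃ (i_ρ x))` is defined
          (∀ v : (iRhoInv ρ (S2.toOp (gen Tt (S2.mk (iRho ρ x) (hi x))))).domain,
            (v : H) ∈ matrixDomain h (extGen T h x) ∧
            ∀ n, matrixApply h (extGen T h x) v n =
              ⟪h n, iRhoInv ρ (S2.toOp (gen Tt (S2.mk (iRho ρ x) (hi x)))) v⟫_ℂ)) := by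
  refine ⟨hρ.isHilbertSchmidt_iRho, fun t => inducedCLM hρ (T t),
    isInducedSemigroup_inducedCLM hρ hT hSchwarz hsub, fun S hS => ?_,
    fun hw => (isInducedSemigroup_inducedCLM hρ hT hSchwarz hsub).isStronglyContinuous hρ hw,
    fun x hx => ?_, fun {ι} h hh x hx => ?_⟩
  all_goals have hi := isInducedSemigroup_inducedCLM hρ hT hSchwarz hsub
  · funext t
    exact eq_of_eq_on_iRhoS2 hρ fun x => (hS.intertwine t x).trans (hi.intertwine t x).symm
  · have hz : IsWeakStarDeriv T x (weakStarGen T x) := by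
      have hx' : ∃ z, IsWeakStarDeriv T x z := hx
      rw [weakStarGen, dif_pos hx']
      exact hx'.choose_spec
    have hlim := hi.tendsto_diffQuot hρ hz
    exact ⟨⟨_, hlim⟩, hlim.limUnder_eq⟩
  · obtain ⟨μ, hb⟩ := hρ.exists_isQuarterEigenbasis h hh
    have hlim := tendsto_inner_diffQuot hρ hb hi hx
    generalize hy : S2.toOp (gen (fun t => inducedCLM hρ (T t))
      (S2.mk (iRho ρ x) (hρ.isHilbertSchmidt_iRho x))) = y
    have hμ : ∀ n, (μ n : ℂ) ≠ 0 := fun n => by exact_mod_cast (hb.pos n).ne'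
    have hent : ∀ n m, extGen T h x n m = ((μ n * μ m : ℝ) : ℂ)⁻¹ *
        ⟪h n, y (h m)⟫_ℂ :=
      fun n m => hy ▸ (hlim n m).limUnder_eq
    have happ : ∀ n, (ρ ^ (1 / 4 : ℝ)) ((μ n : ℂ)⁻¹ • h n) = h n := fun n => by
      rw [map_smul, hb.apply, smul_smul, inv_mul_cancel₀ (hμ n), one_smul]
    have hd : ∀ n, h n ∈ (pinv (ρ ^ (1 / 4 : ℝ))).domain := fun n =>
      happ n ▸ rpow_quarter_apply_mem_pinv_domain hρ _
    refine ⟨fun n m => ⟨_, hlim n m⟩, ⟨hd, fun n m => ?_⟩, fun v => ?_⟩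
    · rw [pinv_eq_of_apply_eq hρ ⟨h n, hd n⟩ (happ n), pinv_eq_of_apply_eq hρ ⟨h m, hd m⟩ (happ m),
        map_smul, inner_smul_left, inner_smul_right, hent, map_inv₀,
        Complex.conj_ofReal]
      push_cast
      rw [mul_inv, mul_assoc]
    · obtain ⟨w, hw, hu⟩ := exists_apply_eq_iRhoInv hρ _ v
      have hsum : ∀ n, HasSum (fun m => extGen T h x n m * ⟪h m, (v : H)⟫_ℂ)
          ⟪h n, iRhoInv ρ y v⟫_ℂ := by
        intro n
        -- Parseval for `⟪y⋆ h_n, w⟫`, divided by `μ n`. Since `⟪h m, v⟫ = μ m ⟪h m, w⟫`, the factor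
        -- `μ m` cancels the one in the matrix entry and the terms agree.
        have h1 := (h.hasSum_inner_mul_inner (star y (h n)) w).mul_left ((μ n : ℂ)⁻¹)
        rw [ContinuousLinearMap.star_eq_adjoint, ContinuousLinearMap.adjoint_inner_left] at h1
        have h2 : (μ n : ℂ)⁻¹ * ⟪h n, y w⟫_ℂ = ⟪h n, iRhoInv ρ y v⟫_ℂ := by
          rw [← hu, ← inner_rpow_quarter, hb.apply, inner_smul_left, Complex.conj_ofReal,
            inv_mul_cancel_left₀ (hμ n)]
        rw [h2] at h1
        refine h1.congr_fun fun m => ?_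
        rw [hent, ← hw, ← inner_rpow_quarter, hb.apply, inner_smul_left, Complex.conj_ofReal,
          ContinuousLinearMap.adjoint_inner_left]
        push_cast
        have := hμ n
        have := hμ m
        field_simp
      exact ⟨fun n => (hsum n).summable, fun n => (hsum n).tsum_eq⟩
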